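/- A Motzkin path of length $n\ge 0$ is a sequence $M=(m_1,\dots,m_n)$ with $m_i\in\{1,0,-1\}$ such that all heights $h_k=m_1+\dots+m_k$ $(0\le k\le n)$ are non-negative and $h_n=0$; $\mathrm{area}(M)=\sum_{k=0}^n h_k$ is the area between $M$ and the $x$-axis. A centred Catalan set of size $n+1$ is an $(n+1)$-element set $S\subseteq\{-n,\dots,n\}$ with $|S\cap\{-i,\dots,i\}|\ge i+1$ for all $0\le i\le n$; its Motzkin path $\mathbf M(S)=(m_1,\dots,m_n)$ is given by $m_i=|\{-i,i\}\cap S|-1$. Writing $S=\{s_1<\dots<s_u<0<s_{u+1}<\dots<s_n\}$ (with $0\in S$), put $\lambda(S)=(u+1-s_{u+1},u+2-s_{u+2},\dots,n-s_n)'$, where $'$ denotes the conjugate Young diagram, and $\mu(S)=(-s_1-u,-s_2-(u-1),\dots,-s_u-1)$. Let $f^{\lambda(S)/\mu(S)}$ be the number of standard Young tableaux of skew shape $\lambda(S)/\mu(S)$. For an integer $l\ge 1$, an $(n,l)$-AS-trapezoid is an array of $n$ centred rows whose $i$-th row from the bottom has $l+2i-1$ entries, in the columns labelled $-i+1,\dots,l+i-1$.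 All entries lie in $\{-1,0,1\}$; all row sums are $1$; the columns labelled $1,\dots,l-1$ have sum $0$; the non-zero entries alternate in sign in every row and every column; and in every column the first non-zero entry from the top, if there is one, is $1$. Let $\mathbf S(A)$ be the set consisting of $0$, of $j-1$ for every column label $j\le 0$ with positive column sum, and of $j-(l-1)$ for every column label $j>0$ with positive column sum. The weight $w_l(M)$ of a Motzkin path $M$ of length $n$ is the number of $(n,l)$-AS-trapezoids $A$ with $\mathbf M(\mathbf S(A))=M$, where $m_i(\mathbf S(A))=|\{-i,i\}\cap\mathbf S(A)|-1$. Theorem. For every Motzkin path $M$ there is a polynomial $P\in\mathbb Q[x]$ of degree exactly $\mathrm{area}(M)$ such that $w_l(M)=P(l)$ for all integers $l\ge 1$; its leading coefficient is $$\frac{1}{\mathrm{area}(M)!}\sum_{S:\ \mathbf M(S)=M} f^{\lambda(S)/\mu(S)},$$ the sum running over all centred Catalan sets $S$ with $\mathbf M(S)=M$. -/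

import Mathlib

/-- A Motzkin path of length `n`: `step i` is the vertical part of the `(i+1)`-st step, so that the
path visits the points `(k, ∑_{i < k} step i)` for `0 ≤ k ≤ n`. -/
structure MotzkinPath (n : ℕ) where
  step : Fin n → ℤ
  step_mem : ∀ i, step i = 1 ∨ step i = 0 ∨ step i = -1
  nonneg : ∀ k : ℕ, k ≤ n → 0 ≤ ∑ i : Fin n with i.val < k, step i
  total : ∑ i : Fin n, step i = 0

namespace MotzkinPath

/-- The height of the path at abscissa `k`. -/
def height {n : ℕ} (M : MotzkinPath n) (k : ℕ) : ℤ :=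
  ∑ i : Fin n with i.val < k, M.step i

/-- The area between the path and the `x`-axis. As the path starts and ends at height `0`, it is
the sum of all its heights (see `two_mul_area` for the trapezoidal form). -/
def area {n : ℕ} (M : MotzkinPath n) : ℕ :=
  ∑ k ∈ Finset.range (n + 1), (M.height k).toNat

/-- Between `k` and `k+1` the region below the path is a trapezoid with parallel sides
`height k` and `height (k+1)`; the areas of these trapezoids add up to `area`. -/
theorem two_mul_area {n : ℕ} (M : MotzkinPath n) :
    2 * (M.area : ℤ) = ∑ k ∈ Finset.range n, (M.height k + M.height (k + 1)) := by
  have h0 : M.height 0 = 0 := by simp [height]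
  have hn : M.height n = 0 := by
    have := M.total
    simpa [height] using this
  have h : (M.area : ℤ) = ∑ k ∈ Finset.range (n + 1), M.height k := by
    unfold area
    push_cast
    refine Finset.sum_congr rfl fun k hk => ?_
    exact Int.toNat_of_nonneg (M.nonneg k (Nat.lt_succ_iff.mp (Finset.mem_range.mp hk)))
  have h1 := Finset.sum_range_succ M.height n
  have h2 := Finset.sum_range_succ' M.height n
  rw [Finset.sum_add_distrib, h]
  linarith

end MotzkinPath

/-- `S` is a centred Catalan set of size `n`. -/
def IsCentredCatalan (n : ℕ) (S : Finset ℤ) : Prop :=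
  S.card = n ∧ S ⊆ Finset.Icc (-(n : ℤ) + 1) ((n : ℤ) - 1) ∧
    ∀ i : ℕ, i < n → i + 1 ≤ (S ∩ Finset.Icc (-(i : ℤ)) (i : ℤ)).card

/-- The steps `m_i(S) = |{-i, i} ∩ S| - 1`, `1 ≤ i ≤ n`, of the Motzkin path of a centred Catalan
set `S` of size `n + 1`; the index `i : Fin n` stands for the step number `i + 1`. -/
def motzkinSteps (n : ℕ) (S : Finset ℤ) : Fin n → ℤ := fun i =>
  ((({-((i.val : ℤ) + 1), (i.val : ℤ) + 1} : Finset ℤ) ∩ S).card : ℤ) - 1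

/-- The non-zero entries alternate in sign (for entries in `{-1, 0, 1}`): any two consecutive
non-zero entries are opposite. -/
def Alternating {ι : Type*} [LinearOrder ι] (f : ι → ℤ) : Prop :=
  ∀ a b, a < b → f a ≠ 0 → f b ≠ 0 → (∀ c, a < c → c < b → f c = 0) → f b = -f a

/-- An `(n, l)`-AS-trapezoid. Rows are indexed by `Fin n` from bottom to top, columns by their
integer labels. The row with index `i : Fin n` is the `(i+1)`-st row from the bottom; it has
`l + 2(i+1) - 1` cells, labelled `-i, …, l + i`. Outside its cells a row is filled up by `0`. -/
@[ext]
structure ASTrapezoid (n l : ℕ) where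
  entry : Fin n → ℤ → ℤ
  entry_mem : ∀ i j, entry i j = 1 ∨ entry i j = 0 ∨ entry i j = -1
  outside : ∀ (i : Fin n) (j : ℤ), j ∉ Finset.Icc (-(i.val : ℤ)) ((l : ℤ) + i.val) → entry i j = 0
  row_sum : ∀ i : Fin n, ∑ j ∈ Finset.Icc (-(i.val : ℤ)) ((l : ℤ) + i.val), entry i j = 1
  central_col_sum : ∀ j : ℤ, 1 ≤ j → j ≤ (l : ℤ) - 1 → ∑ i : Fin n, entry i j = 0
  row_alternating : ∀ i, Alternating (entry i)
  col_alternating : ∀ j, Alternating (fun i => entry i j)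
  col_top_pos : ∀ i j, entry i j ≠ 0 → (∀ i', i < i' → entry i' j = 0) → 0 < entry i j

/-- The centred Catalan set `S(A)` of an AS-trapezoid: take the columns (with labels
`-n+1, …, l+n-1`) of positive column sum, subtract `1` from the non-positive labels and `l - 1` from
the positive ones, and add the element `0`. -/
noncomputable def ASTrapezoid.catalanSet {n l : ℕ} (A : ASTrapezoid n l) : Finset ℤ :=
  insert 0 (((Finset.Icc (-(n : ℤ) + 1) ((l : ℤ) + n - 1)).filter
    fun j => 0 < ∑ i : Fin n, A.entry i j).image
      fun j => if j ≤ 0 then j - 1 else j - ((l : ℤ) - 1))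

/-- The weight `w_l(M)`: the number of `(n, l)`-AS-trapezoids `A` whose Motzkin path `M(S(A))`
is `M`. -/
noncomputable def motzkinWeight {n : ℕ} (l : ℕ) (M : MotzkinPath n) : ℕ :=
  Nat.card {A : ASTrapezoid n l // motzkinSteps n A.catalanSet = M.step}

/-- The negative elements `s_1 < … < s_u` of `S`. -/
def negElems (S : Finset ℤ) : List ℤ := (S.filter (· < 0)).sort (· ≤ ·)

/-- The positive elements `s_{u+1} < … < s_n` of `S`. -/
def posElems (S : Finset ℤ) : List ℤ := (S.filter (0 < ·)).sort (· ≤ ·)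

/-- The column lengths `u + 1 - s_{u+1}, …, n - s_n` of `λ(S)`
(all non-negative for a centred Catalan set `S`). -/
def lambdaColLens (S : Finset ℤ) : List ℕ :=
  (posElems S).mapIdx fun j s => (((negElems S).length : ℤ) + ((j : ℤ) + 1) - s).toNat

/-- The row lengths `-s_1 - u, …, -s_u - 1` of `μ(S)`
(all non-negative for a centred Catalan set `S`). -/
def muRowLens (S : Finset ℤ) : List ℕ :=
  (negElems S).mapIdx fun j s => (-s - (((negElems S).length : ℤ) - (j : ℤ))).toNat

theorem strictSort_add_le {L : List ℤ} (hL : L.Pairwise (· < ·)) (i j : ℕ) (hij : i ≤ j)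
    (hj : j < L.length) : L[i] + ((j : ℤ) - i) ≤ L[j] := by
  induction j, hij using Nat.le_induction with
  | base => simp
  | succ k hk ih =>
    have h1 := ih (by omega)
    have h2 := List.pairwise_iff_getElem.mp hL k (k + 1) (by omega) hj (by omega)
    push_cast
    omega

theorem lambdaColLens_sortedGE (S : Finset ℤ) : (lambdaColLens S).SortedGE := by
  have hL : (posElems S).Pairwise (· < ·) := (Finset.sortedLT_sort _).pairwise
  refine List.Pairwise.sortedGE (List.pairwise_iff_getElem.mpr ?_)
  intro i j hi hj hij
  simp only [lambdaColLens, List.length_mapIdx] at hi hj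
  have := strictSort_add_le hL i j hij.le hj
  simp only [lambdaColLens, List.getElem_mapIdx]
  apply Int.toNat_le_toNat
  omega

theorem muRowLens_sortedGE (S : Finset ℤ) : (muRowLens S).SortedGE := by
  have hL : (negElems S).Pairwise (· < ·) := (Finset.sortedLT_sort _).pairwise
  refine List.Pairwise.sortedGE (List.pairwise_iff_getElem.mpr ?_)
  intro i j hi hj hij
  simp only [muRowLens, List.length_mapIdx] at hi hj
  have := strictSort_add_le hL i j hij.le hj
  simp only [muRowLens, List.getElem_mapIdx]
  apply Int.toNat_le_toNat
  omega

/-- The Young diagram `λ(S) = (u + 1 - s_{u+1}, …, n - s_n)'`, the prime denoting conjugation. -/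
def lambdaDiagram (S : Finset ℤ) : YoungDiagram :=
  (YoungDiagram.ofRowLens (lambdaColLens S) (lambdaColLens_sortedGE S)).transpose

/-- The Young diagram `μ(S) = (-s_1 - u, …, -s_u - 1)`. -/
def muDiagram (S : Finset ℤ) : YoungDiagram :=
  YoungDiagram.ofRowLens (muRowLens S) (muRowLens_sortedGE S)

/-- The cells of the skew shape `lam / mu`; the cell `(i, j)` lies in row `i` and column `j`. -/
def skewCells (lam mu : YoungDiagram) : Finset (ℕ × ℕ) := lam.cells \ mu.cells

/-- `f^{lam / mu}`: the number of standard Young tableaux of skew shape `lam / mu`, i.e. of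
bijective fillings of its cells with `|lam / mu|` consecutive numbers (here `0, …, |lam / mu| - 1`)
that increase along rows and along columns. -/
noncomputable def numSkewSYT (lam mu : YoungDiagram) : ℕ :=
  Nat.card {T : skewCells lam mu ≃ Fin (skewCells lam mu).card //
    (∀ c d : skewCells lam mu, c.val.1 = d.val.1 → c.val.2 < d.val.2 → T c < T d) ∧
    (∀ c d : skewCells lam mu, c.val.2 = d.val.2 → c.val.1 < d.val.1 → T c < T d)}

open Classical in
/-- The centred Catalan sets `S` with `M(S) = M` (of size `n + 1` for `M` of length `n`). -/
noncomputable def catalanSetsOver {n : ℕ} (M : MotzkinPath n) : Finset (Finset ℤ) :=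
  (Finset.Icc (-(n : ℤ)) (n : ℤ)).powerset.filter
    fun S => IsCentredCatalan (n + 1) S ∧ motzkinSteps n S = M.step

/-! A zero column among the `l - 1` central ones can be deleted or inserted without changing any
defining condition or the set `S(A)`. Sorting trapezoids by the set of their non-zero central
columns therefore gives `w_l(M) = ∑ m, (l - 1).choose m * c m`, where `c m` (`fullWeight`) counts
the trapezoids over `M` with exactly `m` central columns, all of them non-zero
(`card_eq_sum_choose`). It remains to show that `c m = 0` for `m > area M` and that `c (area M)` is
the sum of the numbers of tableaux.

Let `tailSum k j` be the sum of column `j` over the rows of index at least `k`; alternation forces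
it into `{0, 1}`. Summed over the columns that meet the lowest `k` rows, these numbers give the
height of the path after `k` steps (`rangeSum_add`, `height_add`), so their total over all `k` is
the area. Each non-zero central column contributes at least `1` to this total, whence the vanishing
beyond the area.

If there are exactly `N = area M` central columns, all inequalities are equalities. Central column
`c` then has tail sum `1` at a single level `f c`, that is, an entry `1` in row `f c` above an entry
`-1` in row `f c - 1`, and the other columns carry at most a `1` in their lowest cell, as dictated
by `S`. The row conditions say that the partial sums of each row lie in `{0, 1}`, which means that
the positions of levels `k` and `k + 1` interlace (`IsLevelFunction`, `card_isFull_eq`).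

A standard tableau of shape `λ(S)/μ(S)` yields the same data: send each entry to its diagonal.
Entries increase along each diagonal, so the tableau can be recovered, and standardness amounts to
interlacing of neighbouring diagonals (`numSkewSYT_eq_card`). Finally `c (area M)` is positive, as
some `S` lies over `M` and every skew shape has a standard filling; so the degree is exactly the
area. -/

/-! ### Alternating sequences and partial sums -/

/-- Partial sums over an initial segment of an alternating sequence that starts with `1` lie in
`{0, 1}`; the last non-zero entry is `1` or `-1` accordingly. -/
theorem Alternating.sum_initial {ι : Type*} [LinearOrder ι] {f : ι → ℤ} (hf : Alternating f)
    (hv : ∀ a, f a = 1 ∨ f a = 0 ∨ f a = -1)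
    (hfirst : ∀ a, f a ≠ 0 → (∀ b, b < a → f b = 0) → 0 < f a) (t : Finset ι)
    (ht : ∀ x ∈ t, ∀ y, y < x → f y ≠ 0 → y ∈ t) :
    (∑ x ∈ t, f x = 0 ∨ ∑ x ∈ t, f x = 1) ∧
      ∀ a ∈ t, f a ≠ 0 → (∀ c ∈ t, a < c → f c = 0) → f a = 2 * ∑ x ∈ t, f x - 1 := by
  induction t using Finset.induction_on_max with
  | empty => simp
  | insert x t hx ih =>
    have hxt : x ∉ t := fun h => lt_irrefl _ (hx x h)
    have ih' := ih fun z hz y hy hy0 => by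
      have := ht z (Finset.mem_insert_of_mem hz) y hy hy0
      rcases Finset.mem_insert.mp this with rfl | h
      · exact absurd (hx z hz) (not_lt.mpr hy.le)
      · exact h
    rw [Finset.sum_insert hxt]
    by_cases h0 : f x = 0
    · refine ⟨by simpa [h0] using ih'.1, fun a ha ha0 hlast => ?_⟩
      rcases Finset.mem_insert.mp ha with rfl | h
      · exact absurd h0 ha0
      · simpa [h0] using ih'.2 a h ha0 fun c hc => hlast c (Finset.mem_insert_of_mem hc)
    · have key : f x = 1 - 2 * ∑ y ∈ t, f y := by
        by_cases hne : (t.filter fun y => f y ≠ 0).Nonempty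
        · set a := (t.filter fun y => f y ≠ 0).max' hne with ha
          have hmem := Finset.mem_filter.mp ((t.filter fun y => f y ≠ 0).max'_mem hne)
          have hbetween : ∀ c ∈ t, a < c → f c = 0 := fun c hc hac => by
            by_contra hc0
            exact absurd ((t.filter fun y => f y ≠ 0).le_max' c (by simp [hc, hc0]))
              (not_le.mpr hac)
          have h1 := ih'.2 a hmem.1 hmem.2 hbetween
          have h2 := hf a x (hx a hmem.1) hmem.2 h0 fun c hac hcx => by
            by_contra hc0
            have := ht x (Finset.mem_insert_self _ _) c hcx hc0
            rcases Finset.mem_insert.mp this with rfl | h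
            · exact lt_irrefl _ hcx
            · exact hc0 (hbetween c h hac)
          linarith
        · have hz : ∀ y ∈ t, f y = 0 := by
            intro y hy
            by_contra h
            exact hne ⟨y, by simp [hy, h]⟩
          have h1 := hfirst x h0 fun b hb => by
            by_contra hb0
            have := ht x (Finset.mem_insert_self _ _) b hb hb0
            rcases Finset.mem_insert.mp this with rfl | h
            · exact lt_irrefl _ hb
            · exact hb0 (hz b h)
          rw [Finset.sum_eq_zero hz]
          rcases hv x with h | h | h <;> omega
      refine ⟨by rcases ih'.1 with h | h <;> omega, fun a ha ha0 hlast => ?_⟩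
      rcases Finset.mem_insert.mp ha with rfl | h
      · linarith
      · exact absurd (hlast x (Finset.mem_insert_self _ _) (hx a h)) h0

/-- A sequence whose partial sums lie in `{0, 1}` is alternating. -/
theorem Alternating.of_sum_Icc {f : ℤ → ℤ} (a : ℤ) (h0 : ∀ j < a, f j = 0)
    (h : ∀ x, ∑ j ∈ Finset.Icc a x, f j = 0 ∨ ∑ j ∈ Finset.Icc a x, f j = 1) :
    Alternating f ∧ ∀ j, f j = 1 ∨ f j = 0 ∨ f j = -1 := by
  have hstep : ∀ x, a ≤ x →
      ∑ j ∈ Finset.Icc a x, f j = ∑ j ∈ Finset.Icc a (x - 1), f j + f x := by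
    intro x hx
    have : Finset.Icc a x = insert x (Finset.Icc a (x - 1)) := by
      ext y; simp only [Finset.mem_Icc, Finset.mem_insert]; omega
    rw [this, Finset.sum_insert (by simp)]
    ring
  have ha : ∀ j, f j ≠ 0 → a ≤ j := fun j hj => by
    by_contra hlt
    exact hj (h0 j (not_le.mp hlt))
  refine ⟨fun x y hxy hx hy hbetween => ?_, fun j => ?_⟩
  · have h1 := hstep x (ha x hx)
    have h2 := hstep y (ha y hy)
    have h3 : ∑ j ∈ Finset.Icc a (y - 1), f j = ∑ j ∈ Finset.Icc a x, f j := by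
      symm
      have hax := ha x hx
      refine Finset.sum_subset (fun z hz => ?_) fun z hz hz' => ?_
      · simp only [Finset.mem_Icc] at hz ⊢; omega
      · simp only [Finset.mem_Icc] at hz hz'
        exact hbetween z (by omega) (by omega)
    rcases h x with h4 | h4 <;> rcases h y with h5 | h5 <;>
      rcases h (x - 1) with h6 | h6 <;> omega
  · by_cases hj : f j = 0
    · exact Or.inr (Or.inl hj)
    · have h1 := hstep j (ha j hj)
      rcases h j with h2 | h2 <;> rcases h (j - 1) with h3 | h3 <;> omega

theorem Alternating.comp_strictMono {ι κ : Type*} [LinearOrder ι] [LinearOrder κ] {f : κ → ℤ}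
    (hf : Alternating f) {φ : ι → κ} (hφ : StrictMono φ) (h0 : ∀ j, j ∉ Set.range φ → f j = 0) :
    Alternating (f ∘ φ) := by
  intro a b hab ha hb hc
  refine hf _ _ (hφ hab) ha hb fun c hac hcb => ?_
  by_cases h : c ∈ Set.range φ
  · obtain ⟨c, rfl⟩ := h
    exact hc c (hφ.lt_iff_lt.mp hac) (hφ.lt_iff_lt.mp hcb)
  · exact h0 c h

theorem Alternating.extend_strictMono {ι κ : Type*} [LinearOrder ι] [LinearOrder κ] {f : ι → ℤ}
    (hf : Alternating f) {φ : ι → κ} (hφ : StrictMono φ) :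
    Alternating (Function.extend φ f 0) := by
  have h0 : ∀ j, Function.extend φ f 0 j ≠ 0 → ∃ i, φ i = j := fun j hj => by
    by_contra h
    exact hj (Function.extend_apply' _ _ _ h)
  intro a b hab ha hb hc
  obtain ⟨a, rfl⟩ := h0 a ha
  obtain ⟨b, rfl⟩ := h0 b hb
  rw [hφ.injective.extend_apply] at ha hb ⊢
  rw [hφ.injective.extend_apply]
  refine hf a b (hφ.lt_iff_lt.mp hab) ha hb fun c hac hcb => ?_
  have := hc (φ c) (hφ hac) (hφ hcb)
  rwa [hφ.injective.extend_apply] at this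

/-! ### Partial column and row sums of AS-trapezoids -/

namespace ASTrapezoid

variable {n l : ℕ}

instance : Finite (ASTrapezoid n l) := by
  let g : ASTrapezoid n l → (Fin n → Finset.Icc (-(n : ℤ)) ((l : ℤ) + n) → ({1, 0, -1} : Set ℤ)) :=
    fun A i j => ⟨A.entry i j, by simpa using A.entry_mem i j⟩
  have : Finite ({1, 0, -1} : Set ℤ) := Set.Finite.to_subtype (by simp)
  refine Finite.of_injective g fun A B hAB => ?_
  ext i j
  by_cases hj : j ∈ Finset.Icc (-(n : ℤ)) ((l : ℤ) + n)
  · exact congrArg Subtype.val (congrFun (congrFun hAB i) ⟨j, hj⟩)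
  · have : j ∉ Finset.Icc (-(i.val : ℤ)) ((l : ℤ) + i.val) := by
      simp only [Finset.mem_Icc] at hj ⊢; omega
    rw [A.outside i j this, B.outside i j this]

/-- The sum of the entries of column `j` in all rows with index at least `k`. -/
def tailSum (A : ASTrapezoid n l) (k : ℕ) (j : ℤ) : ℤ :=
  ∑ i : Fin n with k ≤ i.val, A.entry i j

theorem tailSum_zero (A : ASTrapezoid n l) (j : ℤ) : A.tailSum 0 j = ∑ i, A.entry i j := by
  simp [tailSum]

theorem tailSum_eq_zero_of_le (A : ASTrapezoid n l) {k : ℕ} (hk : n ≤ k) (j : ℤ) :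
    A.tailSum k j = 0 := by
  refine Finset.sum_eq_zero fun i hi => ?_
  have := (Finset.mem_filter.mp hi).2
  omega

theorem tailSum_eq_add (A : ASTrapezoid n l) (i : Fin n) (j : ℤ) :
    A.tailSum i j = A.entry i j + A.tailSum (i + 1) j := by
  have : (Finset.univ.filter fun i' : Fin n => i.val ≤ i'.val) =
      insert i (Finset.univ.filter fun i' : Fin n => i.val + 1 ≤ i'.val) := by
    ext i'
    simp only [Finset.mem_filter, Finset.mem_univ, true_and, Finset.mem_insert, Fin.ext_iff]
    omega
  rw [tailSum, this, Finset.sum_insert (by simp), tailSum]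

theorem tailSum_mem (A : ASTrapezoid n l) (k : ℕ) (j : ℤ) :
    A.tailSum k j = 0 ∨ A.tailSum k j = 1 := by
  -- Columns start with `1` when read from the top, hence the reversed order on rows.
  have halt : Alternating fun i : (Fin n)ᵒᵈ => A.entry (OrderDual.ofDual i) j := by
    intro a b hab ha hb hc
    have := A.col_alternating j (OrderDual.ofDual b) (OrderDual.ofDual a) hab hb ha
      fun c h1 h2 => hc (OrderDual.toDual c) h2 h1
    change A.entry _ j = -A.entry _ j at this
    change A.entry _ j = -A.entry _ j
    rw [this, neg_neg]
  have := (halt.sum_initial (fun a => A.entry_mem _ _)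
    (fun a ha hb => A.col_top_pos _ _ ha fun i' hi' => hb (OrderDual.toDual i') hi')
    ((Finset.univ.filter fun i : Fin n => k ≤ i.val).map OrderDual.toDual.toEmbedding)
    (by
      intro x hx y hy _
      simp only [Finset.mem_map_equiv, Finset.mem_filter, Finset.mem_univ, true_and] at hx ⊢
      have : OrderDual.ofDual x < OrderDual.ofDual y := hy
      exact hx.trans (Fin.lt_def.mp this).le)).1
  simpa [tailSum] using this

/-- That a row starts with `1` is not an axiom but follows from its sum: if the first non-zero entry
were `-1`, the negated row would have total `0` or `1`, contradicting row sum `1`. -/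
theorem sum_Icc_mem (A : ASTrapezoid n l) (i : Fin n) (x : ℤ) :
    ∑ j ∈ Finset.Icc (-(i.val : ℤ)) x, A.entry i j = 0 ∨
      ∑ j ∈ Finset.Icc (-(i.val : ℤ)) x, A.entry i j = 1 := by
  have hlow : ∀ j, A.entry i j ≠ 0 → -(i.val : ℤ) ≤ j ∧ j ≤ (l : ℤ) + i.val := fun j hj => by
    by_contra h
    exact hj (A.outside i j (by simpa using h))
  have hinit : ∀ x, ∀ z ∈ Finset.Icc (-(i.val : ℤ)) x, ∀ y, y < z → A.entry i y ≠ 0 →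
      y ∈ Finset.Icc (-(i.val : ℤ)) x := by
    intro x z hz y hyz hy
    simp only [Finset.mem_Icc] at hz ⊢
    have := hlow y hy
    omega
  refine ((A.row_alternating i).sum_initial (A.entry_mem i) (fun a ha hb => ?_) _ (hinit x)).1
  by_contra hneg
  have halt : Alternating fun j => -A.entry i j := by
    intro a b hab ha hb hc
    have := A.row_alternating i a b hab (by simpa using ha) (by simpa using hb)
      fun c h1 h2 => by simpa using hc c h1 h2
    simp only
    omega
  have h1 := (halt.sum_initial (fun a => by have := A.entry_mem i a; omega)
    (fun c hc hc' => by
      have hca : c = a := by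
        rcases lt_trichotomy c a with h | h | h
        · exact absurd (hb c h) (by simpa using hc)
        · exact h
        · exact absurd (hc' a h) (by simpa using ha)
      subst hca
      have : A.entry i c ≠ 0 := ha
      omega) (Finset.Icc (-(i.val : ℤ)) ((l : ℤ) + i.val))
    (fun z hz y hyz hy => hinit _ z hz y hyz (by simpa using hy))).1
  rw [Finset.sum_neg_distrib, A.row_sum i] at h1
  omega

/-- Columns outside the trapezoid and central columns have sum `0`, so the range condition on labels
can be dropped and the two shifts have disjoint images, the negative and the positive integers. -/
theorem mem_catalanSet (A : ASTrapezoid n l) (hl : 1 ≤ l) (x : ℤ) :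
    x ∈ A.catalanSet ↔ x = 0 ∨ (x < 0 ∧ 0 < A.tailSum 0 (x + 1)) ∨
      (0 < x ∧ 0 < A.tailSum 0 (x + ((l : ℤ) - 1))) := by
  have hrange : ∀ j, 0 < A.tailSum 0 j → -(n : ℤ) + 1 ≤ j ∧ j ≤ (l : ℤ) + n - 1 := by
    intro j hj
    by_contra hcon
    rw [tailSum_zero, Finset.sum_eq_zero] at hj
    · exact lt_irrefl _ hj
    · intro i _
      refine A.outside i j ?_
      have := i.isLt
      simp only [Finset.mem_Icc]
      omega
  have hcentral : ∀ j, 0 < A.tailSum 0 j → 1 ≤ j → (l : ℤ) ≤ j := by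
    intro j hj h1
    by_contra hcon
    rw [tailSum_zero, A.central_col_sum j h1 (by omega)] at hj
    exact lt_irrefl _ hj
  simp only [catalanSet, Finset.mem_insert, Finset.mem_image, Finset.mem_filter, Finset.mem_Icc,
    ← tailSum_zero]
  constructor
  · rintro (h | ⟨j, ⟨-, hj⟩, rfl⟩)
    · exact Or.inl h
    · split_ifs with h0
      · exact Or.inr (Or.inl ⟨by omega, by simpa using hj⟩)
      · have := hcentral j hj (by omega)
        exact Or.inr (Or.inr ⟨by omega, by simpa using hj⟩)
  · rintro (h | ⟨h, hj⟩ | ⟨h, hj⟩)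
    · exact Or.inl h
    · exact Or.inr ⟨x + 1, ⟨hrange _ hj, hj⟩, by rw [if_pos (by omega)]; ring⟩
    · exact Or.inr ⟨_, ⟨hrange _ hj, hj⟩, by rw [if_neg (by omega)]; ring⟩

end ASTrapezoid

/-! ### Inserting and deleting zero columns -/

theorem Finset.sum_Icc_extend {φ : ℤ → ℤ} (hφ : StrictMono φ) (g : ℤ → ℤ) (a b : ℤ) :
    ∑ j ∈ Finset.Icc (φ a) (φ b), Function.extend φ g 0 j = ∑ j ∈ Finset.Icc a b, g j := by
  have h1 : ∑ j ∈ Finset.Icc a b, g j =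
      ∑ j ∈ (Finset.Icc a b).image φ, Function.extend φ g 0 j := by
    rw [Finset.sum_image fun x _ y _ h => hφ.injective h]
    exact Finset.sum_congr rfl fun j _ => (hφ.injective.extend_apply _ _ _).symm
  rw [h1]
  symm
  refine Finset.sum_subset (fun y hy => ?_) fun y hy hy' => ?_
  · obtain ⟨x, hx, rfl⟩ := Finset.mem_image.mp hy
    rw [Finset.mem_Icc] at hx ⊢
    exact ⟨hφ.monotone hx.1, hφ.monotone hx.2⟩
  · refine Function.extend_apply' _ _ _ ?_
    rintro ⟨x, rfl⟩
    rw [Finset.mem_Icc, hφ.le_iff_le, hφ.le_iff_le] at hy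
    exact hy' (Finset.mem_image_of_mem _ (Finset.mem_Icc.mpr hy))

/-- A strictly increasing map of column labels that fixes the non-positive labels and maps the
labels `k, k + 1, …` onto `l, l + 1, …` by translation. -/
structure IsRelabelling (k l : ℕ) (φ : ℤ → ℤ) : Prop where
  strictMono : StrictMono φ
  left : ∀ j ≤ 0, φ j = j
  right : ∀ j, (k : ℤ) ≤ j → φ j = j + ((l : ℤ) - k)

/-- Every set of labels between `1` and `l - 1` is the image of an initial segment under a
relabelling. -/
theorem exists_isRelabelling {l : ℕ} (hl : 1 ≤ l) (Z : Finset ℤ)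
    (hZ : Z ⊆ Finset.Icc 1 ((l : ℤ) - 1)) :
    ∃ φ, IsRelabelling (Z.card + 1) l φ ∧ ∀ j, j ∈ Z ↔ ∃ i, 1 ≤ i ∧ i ≤ (Z.card : ℤ) ∧ φ i = j := by
  have hmem : ∀ i, Z.orderEmbOfFin rfl i ∈ Finset.Icc 1 ((l : ℤ) - 1) :=
    fun i => hZ (Z.orderEmbOfFin_mem rfl i)
  simp only [Finset.mem_Icc] at hmem
  -- The labels `1, …, |Z|` enumerate `Z` increasingly; with `k = |Z| + 1` the labels from `k` on
  -- are shifted by `l - k`.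
  let φ : ℤ → ℤ := fun j =>
    if h : 1 ≤ j ∧ j ≤ Z.card then Z.orderEmbOfFin rfl ⟨(j - 1).toNat, by omega⟩
    else if j ≤ 0 then j else j + ((l : ℤ) - (Z.card + 1))
  have hmid : ∀ (j : ℤ) (h : 1 ≤ j ∧ j ≤ Z.card),
      φ j = Z.orderEmbOfFin rfl ⟨(j - 1).toNat, by omega⟩ := fun j h => dif_pos h
  have hleft : ∀ j ≤ 0, φ j = j := fun j hj => by
    simp only [φ]; rw [dif_neg (by omega), if_pos hj]
  have hright : ∀ j, (Z.card : ℤ) + 1 ≤ j → φ j = j + ((l : ℤ) - (Z.card + 1)) := fun j hj => by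
    simp only [φ]; rw [dif_neg (by omega), if_neg (by omega)]
  refine ⟨φ, ⟨fun a b hab => ?_, hleft, by simpa using hright⟩, fun j => ⟨fun hj => ?_, ?_⟩⟩
  · by_cases ha : 1 ≤ a ∧ a ≤ Z.card
    · rw [hmid a ha]
      by_cases hb : 1 ≤ b ∧ b ≤ Z.card
      · rw [hmid b hb, OrderEmbedding.lt_iff_lt, Fin.mk_lt_mk]
        omega
      · rw [hright b (by omega)]
        have := hmem ⟨(a - 1).toNat, by omega⟩
        omega
    · by_cases ha0 : a ≤ 0
      · rw [hleft a ha0]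
        by_cases hb : 1 ≤ b ∧ b ≤ Z.card
        · rw [hmid b hb]
          have := hmem ⟨(b - 1).toNat, by omega⟩
          omega
        · by_cases hb0 : b ≤ 0
          · rw [hleft b hb0]; exact hab
          · rw [hright b (by omega)]
            have : Z.card ≤ l - 1 := by simpa using Finset.card_le_card hZ
            omega
      · rw [hright a (by omega), hright b (by omega)]
        omega
  · have : j ∈ Set.range (Z.orderEmbOfFin rfl) := by simpa using hj
    obtain ⟨i, rfl⟩ := this
    refine ⟨(i.val : ℤ) + 1, by omega, by omega, ?_⟩
    rw [hmid _ (by omega)]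
    congr 2
    simp
  · rintro ⟨i, h1, h2, rfl⟩
    rw [hmid i ⟨h1, h2⟩]
    exact Z.orderEmbOfFin_mem rfl _

namespace IsRelabelling

variable {k l : ℕ} {φ : ℤ → ℤ}

theorem mem_range_of_notMem (hφ : IsRelabelling k l φ) {j : ℤ}
    (hj : ¬(1 ≤ j ∧ j ≤ (l : ℤ) - 1)) : j ∈ Set.range φ := by
  by_cases h0 : j ≤ 0
  · exact ⟨j, hφ.left j h0⟩
  · exact ⟨j - ((l : ℤ) - k), by rw [hφ.right _ (by omega)]; ring⟩

/-- Since `φ 0 = 0` and `φ k = l`, strict monotonicity preserves and reflects being strictly between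
the two. -/
theorem central_iff (hφ : IsRelabelling k l φ) (j : ℤ) :
    (1 ≤ φ j ∧ φ j ≤ (l : ℤ) - 1) ↔ (1 ≤ j ∧ j ≤ (k : ℤ) - 1) := by
  have h0 := hφ.left 0 le_rfl
  have h1 := hφ.right k le_rfl
  have h2 := hφ.strictMono.lt_iff_lt (a := 0) (b := j)
  have h3 := hφ.strictMono.lt_iff_lt (a := j) (b := (k : ℤ))
  omega

end IsRelabelling

namespace ASTrapezoid

variable {n k l : ℕ} {φ : ℤ → ℤ}

/-- Insert zero columns: column `j` becomes column `φ j`. -/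
noncomputable def expand (hφ : IsRelabelling k l φ) (B : ASTrapezoid n k) :
    ASTrapezoid n l where
  entry i := Function.extend φ (B.entry i) 0
  entry_mem i j := by
    by_cases h : ∃ j', φ j' = j
    · obtain ⟨j, rfl⟩ := h
      rw [hφ.strictMono.injective.extend_apply]
      exact B.entry_mem i j
    · rw [Function.extend_apply' _ _ _ h]
      simp
  outside i j hj := by
    by_cases h : ∃ j', φ j' = j
    · obtain ⟨j, rfl⟩ := h
      rw [hφ.strictMono.injective.extend_apply]
      refine B.outside i j fun hj' => hj ?_
      rw [Finset.mem_Icc] at hj' ⊢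
      have h1 := hφ.strictMono.monotone hj'.1
      have h2 := hφ.strictMono.monotone hj'.2
      rw [hφ.left _ (by omega)] at h1
      rw [hφ.right ((k : ℤ) + i.val) (by omega)] at h2
      omega
    · rw [Function.extend_apply' _ _ _ h]
      rfl
  row_sum i := by
    have h := Finset.sum_Icc_extend hφ.strictMono (B.entry i) (-(i.val : ℤ)) ((k : ℤ) + i.val)
    rw [B.row_sum, hφ.left _ (by omega), hφ.right ((k : ℤ) + i.val) (by omega)] at h
    rwa [show (l : ℤ) + i.val = (k : ℤ) + i.val + ((l : ℤ) - k) by ring]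
  central_col_sum j h1 h2 := by
    by_cases h : ∃ j', φ j' = j
    · obtain ⟨j, rfl⟩ := h
      have := (hφ.central_iff j).mp ⟨h1, h2⟩
      simp only [hφ.strictMono.injective.extend_apply]
      exact B.central_col_sum j this.1 this.2
    · simp only [Function.extend_apply' _ _ _ h]
      simp
  row_alternating i := (B.row_alternating i).extend_strictMono hφ.strictMono
  col_alternating j := by
    by_cases h : ∃ j', φ j' = j
    · obtain ⟨j, rfl⟩ := h
      simp only [hφ.strictMono.injective.extend_apply]
      exact B.col_alternating j
    · simp only [Function.extend_apply' _ _ _ h]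
      intro a b _ ha
      exact absurd rfl ha
  col_top_pos i j := by
    by_cases h : ∃ j', φ j' = j
    · obtain ⟨j, rfl⟩ := h
      simp only [hφ.strictMono.injective.extend_apply]
      exact B.col_top_pos i j
    · simp only [Function.extend_apply' _ _ _ h]
      intro ha
      exact absurd rfl ha

theorem expand_entry (hφ : IsRelabelling k l φ) (B : ASTrapezoid n k) (i : Fin n)
    (j : ℤ) : (B.expand hφ).entry i (φ j) = B.entry i j :=
  hφ.strictMono.injective.extend_apply _ _ _

theorem expand_entry_of_notMem_range (hφ : IsRelabelling k l φ) (B : ASTrapezoid n k)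
    (i : Fin n) {j : ℤ} (hj : j ∉ Set.range φ) : (B.expand hφ).entry i j = 0 :=
  Function.extend_apply' _ _ _ hj

theorem expand_injective (hφ : IsRelabelling k l φ) :
    Function.Injective (expand (n := n) hφ) := by
  intro B B' h
  ext i j
  rw [← expand_entry hφ B, ← expand_entry hφ B', h]

/-- Delete the zero columns whose labels are not values of `φ`. -/
def compress (hφ : IsRelabelling k l φ) (A : ASTrapezoid n l)
    (hA : ∀ i, ∀ j ∉ Set.range φ, A.entry i j = 0) : ASTrapezoid n k where
  entry i j := A.entry i (φ j)
  entry_mem i j := A.entry_mem i (φ j)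
  outside i j hj := by
    refine A.outside i _ fun hj' => hj ?_
    rw [Finset.mem_Icc] at hj' ⊢
    have h1 := hφ.strictMono.le_iff_le (a := -(i.val : ℤ)) (b := j)
    have h2 := hφ.strictMono.le_iff_le (a := j) (b := (k : ℤ) + i.val)
    rw [hφ.left _ (by omega)] at h1
    rw [hφ.right ((k : ℤ) + i.val) (by omega)] at h2
    omega
  row_sum i := by
    rw [← Finset.sum_Icc_extend hφ.strictMono, ← A.row_sum i, hφ.left _ (by omega),
      hφ.right ((k : ℤ) + i.val) (by omega)]
    refine Finset.sum_congr (by congr 1; ring) fun j _ => ?_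
    by_cases h : ∃ j', φ j' = j
    · obtain ⟨j, rfl⟩ := h
      rw [hφ.strictMono.injective.extend_apply]
    · rw [Function.extend_apply' _ _ _ h, hA i j h]
      rfl
  central_col_sum j h1 h2 := by
    have := (hφ.central_iff j).mpr ⟨h1, h2⟩
    exact A.central_col_sum _ this.1 this.2
  row_alternating i := (A.row_alternating i).comp_strictMono hφ.strictMono (hA i)
  col_alternating j := A.col_alternating _
  col_top_pos i j := A.col_top_pos i _

theorem expand_compress (hφ : IsRelabelling k l φ) (A : ASTrapezoid n l)
    (hA : ∀ i, ∀ j ∉ Set.range φ, A.entry i j = 0) :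
    (A.compress hφ hA).expand hφ = A := by
  ext i j
  by_cases h : j ∈ Set.range φ
  · obtain ⟨j, rfl⟩ := h
    rw [expand_entry]
    rfl
  · rw [expand_entry_of_notMem_range hφ _ i h, hA i j h]

theorem catalanSet_expand (hφ : IsRelabelling k l φ) (hk : 1 ≤ k) (hl : 1 ≤ l)
    (B : ASTrapezoid n k) : (B.expand hφ).catalanSet = B.catalanSet := by
  have h : ∀ j, (B.expand hφ).tailSum 0 (φ j) = B.tailSum 0 j := fun j => by
    simp only [tailSum, expand_entry]
  ext x
  rw [mem_catalanSet _ hl, mem_catalanSet _ hk]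
  refine or_congr_right (or_congr (and_congr_right fun hx => ?_) (and_congr_right fun hx => ?_))
  · rw [← h, hφ.left _ (by omega)]
  · rw [← h, hφ.right _ (by omega)]
    ring_nf

/-! ### Sorting trapezoids by their non-zero central columns -/

open Classical in
/-- The labels of the non-zero central columns. -/
noncomputable def activeCols (A : ASTrapezoid n l) : Finset ℤ :=
  (Finset.Icc 1 ((l : ℤ) - 1)).filter fun j => ∃ i, A.entry i j ≠ 0

theorem mem_activeCols (A : ASTrapezoid n l) (j : ℤ) :
    j ∈ A.activeCols ↔ (1 ≤ j ∧ j ≤ (l : ℤ) - 1) ∧ ∃ i, A.entry i j ≠ 0 := by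
  simp [activeCols]

/-- All central columns are non-zero. -/
def IsFull (A : ASTrapezoid n l) : Prop :=
  ∀ j : ℤ, 1 ≤ j → j ≤ (l : ℤ) - 1 → ∃ i, A.entry i j ≠ 0

/-- Trapezoids whose non-zero central columns have labels in `Z` are obtained from full trapezoids
by inserting zero columns. -/
theorem card_activeCols_eq (hl : 1 ≤ l) (Q : Finset ℤ → Prop) (Z : Finset ℤ)
    (hZ : Z ⊆ Finset.Icc 1 ((l : ℤ) - 1)) :
    Nat.card {A : ASTrapezoid n l // Q A.catalanSet ∧ A.activeCols = Z} =
      Nat.card {B : ASTrapezoid n (Z.card + 1) // Q B.catalanSet ∧ B.IsFull} := by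
  obtain ⟨φ, hφ, hφZ⟩ := exists_isRelabelling hl Z hZ
  have hk : 1 ≤ Z.card + 1 := by omega
  have hactive : ∀ B : ASTrapezoid n (Z.card + 1), B.IsFull → (B.expand hφ).activeCols = Z := by
    intro B hB
    ext j
    rw [mem_activeCols]
    constructor
    · rintro ⟨h1, i, hi⟩
      by_cases h : j ∈ Set.range φ
      · obtain ⟨j, rfl⟩ := h
        have := (hφ.central_iff j).mp h1
        exact (hφZ _).mpr ⟨j, this.1, by push_cast at this; omega, rfl⟩
      · exact absurd (expand_entry_of_notMem_range hφ B i h) hi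
    · intro hj
      obtain ⟨j', h1, h2, rfl⟩ := (hφZ j).mp hj
      refine ⟨Finset.mem_Icc.mp (hZ hj), ?_⟩
      simp only [expand_entry]
      exact hB j' h1 (by push_cast; omega)
  symm
  refine Nat.card_congr (Equiv.ofBijective
    (fun B => ⟨B.1.expand hφ, by rw [catalanSet_expand hφ hk hl]; exact B.2.1,
      hactive B.1 B.2.2⟩) ⟨fun B B' h => ?_, ?_⟩)
  · exact Subtype.ext (expand_injective hφ (congrArg Subtype.val h))
  · rintro ⟨A, hQ, hA⟩
    have hzero : ∀ i, ∀ j ∉ Set.range φ, A.entry i j = 0 := by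
      intro i j hj
      by_contra hne
      have h1 : 1 ≤ j ∧ j ≤ (l : ℤ) - 1 := by
        by_contra h1
        exact hj (hφ.mem_range_of_notMem h1)
      have : j ∈ Z := hA ▸ (A.mem_activeCols j).mpr ⟨h1, i, hne⟩
      obtain ⟨j', -, -, h⟩ := (hφZ j).mp this
      exact hj ⟨j', h⟩
    have hexp := expand_compress hφ A hzero
    refine ⟨⟨A.compress hφ hzero, ?_, fun j h1 h2 => ?_⟩, Subtype.ext hexp⟩
    · rw [← catalanSet_expand hφ hk hl, hexp]
      exact hQ
    · have : φ j ∈ Z := (hφZ _).mpr ⟨j, h1, by push_cast at h2; omega, rfl⟩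
      rw [← hA, mem_activeCols] at this
      exact this.2

/-- Expansion of the number of trapezoids with prescribed centred Catalan set in binomial
coefficients. -/
theorem card_eq_sum_choose (n : ℕ) (hl : 1 ≤ l) (Q : Finset ℤ → Prop) :
    Nat.card {A : ASTrapezoid n l // Q A.catalanSet} =
      ∑ m ∈ Finset.range l, (l - 1).choose m *
        Nat.card {B : ASTrapezoid n (m + 1) // Q B.catalanSet ∧ B.IsFull} := by
  let X := (Finset.Icc 1 ((l : ℤ) - 1)).powerset
  have e : {A : ASTrapezoid n l // Q A.catalanSet} ≃
      Σ Z : X, {A : ASTrapezoid n l // Q A.catalanSet ∧ A.activeCols = Z.1} :=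
    { toFun := fun A => ⟨⟨A.1.activeCols, Finset.mem_powerset.mpr (Finset.filter_subset _ _)⟩,
        A.1, A.2, rfl⟩
      invFun := fun s => ⟨s.2.1, s.2.2.1⟩
      left_inv := fun A => rfl
      right_inv := by
        rintro ⟨⟨Z, hZ⟩, A, hA, h⟩
        change A.activeCols = Z at h
        subst h
        rfl }
  rw [Nat.card_congr e, Nat.card_sigma,
    Finset.sum_congr rfl fun Z _ => card_activeCols_eq hl Q Z.1 (Finset.mem_powerset.mp Z.2),
    Finset.sum_coe_sort X fun Z =>
      Nat.card {B : ASTrapezoid n (Z.card + 1) // Q B.catalanSet ∧ B.IsFull},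
    Finset.sum_powerset_apply_card fun m =>
      Nat.card {B : ASTrapezoid n (m + 1) // Q B.catalanSet ∧ B.IsFull}]
  have hcard : (Finset.Icc 1 ((l : ℤ) - 1)).card = l - 1 := by
    rw [Int.card_Icc]; omega
  rw [hcard, Nat.sub_add_cancel hl]
  simp [smul_eq_mul]

end ASTrapezoid

/-! ### The cells of the skew shape `λ(S) / μ(S)` -/

/-- The number of elements of `S` in `{-k, …, -1}`. -/
def negCount (S : Finset ℤ) (k : ℕ) : ℕ := (S.filter fun x => -(k : ℤ) ≤ x ∧ x < 0).card

/-- The number of elements of `S` in `{1, …, k}`. -/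
def posCount (S : Finset ℤ) (k : ℕ) : ℕ := (S.filter fun x => 0 < x ∧ x ≤ (k : ℤ)).card

/-- The indicator of `-(k + 1) ∈ S`. -/
def negInd (S : Finset ℤ) (k : ℕ) : ℕ := if -((k : ℤ) + 1) ∈ S then 1 else 0

/-- The indicator of `k + 1 ∈ S`. -/
def posInd (S : Finset ℤ) (k : ℕ) : ℕ := if (k : ℤ) + 1 ∈ S then 1 else 0

theorem negInd_le_one (S : Finset ℤ) (k : ℕ) : negInd S k ≤ 1 := by
  unfold negInd; split_ifs <;> simp

theorem posInd_le_one (S : Finset ℤ) (k : ℕ) : posInd S k ≤ 1 := by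
  unfold posInd; split_ifs <;> simp

theorem negCount_succ (S : Finset ℤ) (k : ℕ) : negCount S (k + 1) = negCount S k + negInd S k := by
  unfold negCount negInd
  split_ifs with h
  · have : (S.filter fun x => -((k + 1 : ℕ) : ℤ) ≤ x ∧ x < 0) =
        insert (-((k : ℤ) + 1)) (S.filter fun x => -(k : ℤ) ≤ x ∧ x < 0) := by
      ext x
      simp only [Finset.mem_filter, Finset.mem_insert]
      constructor
      · rintro ⟨h1, h2⟩
        by_cases hx : x = -((k : ℤ) + 1)
        · exact Or.inl hx
        · exact Or.inr ⟨h1, by push_cast at h2; omega⟩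
      · rintro (rfl | ⟨h1, h2⟩)
        · exact ⟨h, by push_cast; omega⟩
        · exact ⟨h1, by push_cast; omega⟩
    rw [this, Finset.card_insert_of_notMem (by simp)]
  · rw [add_zero]
    congr 1
    refine Finset.filter_congr fun x hx => ?_
    have : x ≠ -((k : ℤ) + 1) := fun h' => h (h' ▸ hx)
    push_cast
    omega

theorem posCount_succ (S : Finset ℤ) (k : ℕ) : posCount S (k + 1) = posCount S k + posInd S k := by
  unfold posCount posInd
  split_ifs with h
  · have : (S.filter fun x => 0 < x ∧ x ≤ ((k + 1 : ℕ) : ℤ)) =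
        insert ((k : ℤ) + 1) (S.filter fun x => 0 < x ∧ x ≤ (k : ℤ)) := by
      ext x
      simp only [Finset.mem_filter, Finset.mem_insert]
      constructor
      · rintro ⟨h1, h2⟩
        by_cases hx : x = (k : ℤ) + 1
        · exact Or.inl hx
        · exact Or.inr ⟨h1, by push_cast at h2; omega⟩
      · rintro (rfl | ⟨h1, h2⟩)
        · exact ⟨h, by push_cast; omega⟩
        · exact ⟨h1, by push_cast; omega⟩
    rw [this, Finset.card_insert_of_notMem (by simp)]
  · rw [add_zero]
    congr 1
    refine Finset.filter_congr fun x hx => ?_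
    have : x ≠ (k : ℤ) + 1 := fun h' => h (h' ▸ hx)
    push_cast
    omega

theorem negCount_zero (S : Finset ℤ) : negCount S 0 = 0 := by
  simp only [negCount, Finset.card_eq_zero, Finset.filter_eq_empty_iff]
  intro x _
  push_cast
  omega

theorem posCount_zero (S : Finset ℤ) : posCount S 0 = 0 := by
  simp only [posCount, Finset.card_eq_zero, Finset.filter_eq_empty_iff]
  intro x _
  push_cast
  omega

theorem negCount_le (S : Finset ℤ) (k : ℕ) : negCount S k ≤ k := by
  induction k with
  | zero => rw [negCount_zero]
  | succ k ih => rw [negCount_succ]; have := negInd_le_one S k; omega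

theorem negCount_mono (S : Finset ℤ) : Monotone (negCount S) :=
  monotone_nat_of_le_succ fun k => by rw [negCount_succ]; omega

/-- In an increasing list the elements that are at most `k` form an initial segment. -/
theorem List.getElem_le_iff_lt_countP {L : List ℤ} (hL : L.Pairwise (· < ·)) (k : ℤ) (i : ℕ)
    (hi : i < L.length) : L[i] ≤ k ↔ i < L.countP (· ≤ k) := by
  induction L generalizing i with
  | nil => simp at hi
  | cons a L ih =>
    rw [List.pairwise_cons] at hL
    have hzero : k < a → L.countP (· ≤ k) = 0 := by
      intro h
      rw [List.countP_eq_zero]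
      intro b hb
      have := hL.1 b hb
      simp only [decide_eq_true_eq]
      omega
    rw [List.countP_cons]
    cases i with
    | zero =>
      simp only [List.getElem_cons_zero]
      by_cases h : a ≤ k
      · simp [h]
      · simp [h, hzero (not_le.mp h)]
    | succ i =>
      have h1 := ih hL.2 i (by simpa using hi)
      simp only [List.getElem_cons_succ]
      rw [h1]
      by_cases h : a ≤ k
      · simp [h]
      · simp [h, hzero (not_le.mp h)]

theorem Finset.getElem_sort_le_iff (F : Finset ℤ) (k : ℤ) (i : ℕ)
    (hi : i < (F.sort (· ≤ ·)).length) :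
    (F.sort (· ≤ ·))[i] ≤ k ↔ i < (F.filter (· ≤ k)).card := by
  rw [List.getElem_le_iff_lt_countP (Finset.sortedLT_sort _).pairwise k i hi]
  have : (F.filter (· ≤ k)).card = Multiset.countP (· ≤ k) F.val := by
    rw [Multiset.countP_eq_card_filter]; rfl
  rw [this, ← Finset.sort_eq F (· ≤ ·), Multiset.coe_countP]

/-- With `u` negative elements, column `s` has length `u + s + 1 - p`, where `p` is the positive
element of index `s`. So the cell belongs to the diagram iff `p ≤ u + s - r`, i.e. iff more than `s`
positive elements are at most `u + s - r`. -/
theorem mem_lambdaDiagram (S : Finset ℤ) (r s : ℕ) :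
    (r, s) ∈ lambdaDiagram S ↔
      r ≤ (negElems S).length + s ∧ s < posCount S ((negElems S).length + s - r) := by
  rw [lambdaDiagram, YoungDiagram.mem_transpose, YoungDiagram.mem_ofRowLens]
  simp only [Prod.fst_swap, Prod.snd_swap, lambdaColLens, List.length_mapIdx,
    List.getElem_mapIdx]
  set u := (negElems S).length
  have hfilter : ∀ k : ℕ, posCount S k = ((S.filter (0 < ·)).filter (· ≤ (k : ℤ))).card :=
    fun k => by rw [Finset.filter_filter]; rfl
  have hlen : (posElems S).length = (S.filter (0 < ·)).card := Finset.length_sort _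
  constructor
  · rintro ⟨hs, h⟩
    have hpos : 0 < (posElems S)[s] := by
      have : (posElems S)[s] ∈ S.filter (0 < ·) := by
        rw [← Finset.mem_sort (· ≤ ·)]
        exact List.getElem_mem hs
      exact (Finset.mem_filter.mp this).2
    have hle : r ≤ u + s := by omega
    refine ⟨hle, ?_⟩
    rw [hfilter]
    exact (Finset.getElem_sort_le_iff _ _ s hs).mp (by change (posElems S)[s] ≤ _; omega)
  · rintro ⟨hle, h⟩
    rw [hfilter] at h
    have hs : s < (posElems S).length := by
      rw [hlen]
      exact h.trans_le (Finset.card_filter_le _ _)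
    have : (posElems S)[s] ≤ _ := (Finset.getElem_sort_le_iff _ _ s hs).mpr h
    exact ⟨hs, by omega⟩

/-- Put `k = u + s - r`. The cell lies in the diagram iff the negative element of index `r` is less
than `-k`, i.e. iff more than `r` elements are; there are `u - negCount S k` of these. -/
theorem mem_muDiagram (S : Finset ℤ) (r s : ℕ) (hle : r ≤ (negElems S).length + s) :
    (r, s) ∈ muDiagram S ↔
      r + negCount S ((negElems S).length + s - r) < (negElems S).length := by
  rw [muDiagram, YoungDiagram.mem_ofRowLens]
  simp only [muRowLens, List.length_mapIdx, List.getElem_mapIdx]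
  have hlen : (negElems S).length = (S.filter (· < 0)).card := Finset.length_sort _
  set u := (negElems S).length
  have hcount : ∀ k : ℕ, negCount S k +
      ((S.filter (· < 0)).filter (· ≤ -(k : ℤ) - 1)).card = (S.filter (· < 0)).card := by
    intro k
    have h := Finset.card_filter_add_card_filter_not (s := S.filter (· < 0))
      (fun x => -(k : ℤ) ≤ x)
    have h1 : negCount S k = ((S.filter (· < 0)).filter fun x => -(k : ℤ) ≤ x).card := by
      rw [Finset.filter_filter, negCount]
      simp only [and_comm]
    have h2 : ∀ x : ℤ, x ≤ -(k : ℤ) - 1 ↔ ¬-(k : ℤ) ≤ x := fun x => by omega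
    simp only [h1, h2]
    exact h
  have hiff : ∀ hr : r < u, (negElems S)[r] ≤ -((u + s - r : ℕ) : ℤ) - 1 ↔
      r + negCount S (u + s - r) < u := fun hr => by
    rw [show ((negElems S)[r] ≤ _) ↔ _ from Finset.getElem_sort_le_iff _ _ r hr]
    have := hcount (u + s - r)
    omega
  constructor
  · rintro ⟨hr, h⟩
    rw [← hiff hr]
    omega
  · intro h
    have hr : r < u := by omega
    refine ⟨hr, ?_⟩
    have := (hiff hr).mpr h
    omega

/-- On a fixed diagonal `u + s - r = k` one condition bounds `s` from above and the other bounds `r`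
from below, so the cells there form a contiguous segment. -/
theorem mem_skewCells_iff (S : Finset ℤ) (r s : ℕ) :
    (r, s) ∈ skewCells (lambdaDiagram S) (muDiagram S) ↔
      r ≤ (negElems S).length + s ∧ s < posCount S ((negElems S).length + s - r) ∧
        (negElems S).length ≤ r + negCount S ((negElems S).length + s - r) := by
  rw [skewCells, Finset.mem_sdiff, YoungDiagram.mem_cells, YoungDiagram.mem_cells,
    mem_lambdaDiagram]
  constructor
  · rintro ⟨⟨h1, h2⟩, h3⟩
    rw [mem_muDiagram S r s h1] at h3
    exact ⟨h1, h2, not_lt.mp h3⟩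
  · rintro ⟨h1, h2, h3⟩
    rw [mem_muDiagram S r s h1]
    exact ⟨⟨h1, h2⟩, not_lt.mpr h3⟩

/-! ### Standard Young tableaux and level functions -/

/-- The number of `c < x` with `f c = k`. -/
def levelCount {N : ℕ} (f : Fin N → ℕ) (k x : ℕ) : ℕ :=
  (Finset.univ.filter fun c : Fin N => c.val < x ∧ f c = k).card

theorem levelCount_mono {N : ℕ} (f : Fin N → ℕ) (k : ℕ) : Monotone (levelCount f k) :=
  fun _ _ hxy => Finset.card_le_card fun c hc => by
    simp only [Finset.mem_filter, Finset.mem_univ, true_and] at hc ⊢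
    exact ⟨hc.1.trans_le hxy, hc.2⟩

theorem levelCount_succ_self {N : ℕ} (f : Fin N → ℕ) (c : Fin N) :
    levelCount f (f c) (c + 1) = levelCount f (f c) c + 1 := by
  have : (Finset.univ.filter fun d : Fin N => d.val < c.val + 1 ∧ f d = f c) =
      insert c (Finset.univ.filter fun d : Fin N => d.val < c.val ∧ f d = f c) := by
    ext d
    simp only [Finset.mem_filter, Finset.mem_univ, true_and, Finset.mem_insert]
    constructor
    · rintro ⟨h1, h2⟩
      by_cases h : d = c
      · exact Or.inl h
      · exact Or.inr ⟨by rw [Fin.ext_iff] at h; omega, h2⟩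
    · rintro (rfl | ⟨h1, h2⟩)
      · simp
      · exact ⟨by omega, h2⟩
  rw [levelCount, this, Finset.card_insert_of_notMem (by simp), levelCount]

theorem levelCount_lt_of_le {N : ℕ} (f : Fin N → ℕ) (c : Fin N) {x : ℕ} (hx : c.val < x) :
    levelCount f (f c) c < levelCount f (f c) x := by
  have h1 := levelCount_mono f (f c) (Nat.succ_le_of_lt hx)
  have h2 := levelCount_succ_self f c
  simp only [Nat.succ_eq_add_one] at h1
  omega

theorem sum_levelCount {N n : ℕ} (f : Fin N → ℕ) (hf : ∀ c, f c < n) :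
    ∑ k ∈ Finset.range n, levelCount f k N = N := by
  have h := Finset.card_eq_sum_card_fiberwise (s := (Finset.univ : Finset (Fin N)))
    (t := Finset.range n) (f := f) fun c _ => by simpa using hf c
  rw [Finset.card_univ, Fintype.card_fin] at h
  conv_rhs => rw [h]
  refine Finset.sum_congr rfl fun k _ => ?_
  simp [levelCount]

/-- The number of positions of level `k`, in terms of `k`, is the height after `k` steps of the
Motzkin path of `S`; the positions of levels `k` and `k + 1` interlace, where an additional
position to the left of all others belongs to level `k` if `-(k + 1) ∈ S`. -/
structure IsLevelFunction (S : Finset ℤ) (n : ℕ) {N : ℕ} (f : Fin N → ℕ) : Prop where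
  pos : ∀ c, 1 ≤ f c
  lt : ∀ c, f c < n
  total : ∀ k ≤ n, levelCount f k N + k = negCount S k + posCount S k
  upper : ∀ k < n, ∀ x ≤ N, levelCount f (k + 1) x ≤ levelCount f k x + negInd S k
  lower : ∀ k < n, ∀ x ≤ N, levelCount f k x + negInd S k ≤ levelCount f (k + 1) x + 1

/-- The counting properties of centred Catalan sets that enter the shape `λ(S) / μ(S)`. -/
structure IsBalanced (S : Finset ℤ) (n : ℕ) : Prop where
  negCount_eq : ∀ k, n ≤ k → negCount S k = (negElems S).length
  posCount_eq : ∀ k, n ≤ k → posCount S k + (negElems S).length = n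
  le : ∀ k ≤ n, k ≤ negCount S k + posCount S k

/-- Standardness of a filling of a skew shape. -/
def IsStandard {lam mu : YoungDiagram} {N : ℕ} (T : skewCells lam mu ≃ Fin N) : Prop :=
  (∀ c d : skewCells lam mu, c.val.1 = d.val.1 → c.val.2 < d.val.2 → T c < T d) ∧
    (∀ c d : skewCells lam mu, c.val.2 = d.val.2 → c.val.1 < d.val.1 → T c < T d)

theorem skewCells_convex {lam mu : YoungDiagram} {r₁ s₁ r₂ s₂ r s : ℕ}
    (h₁ : (r₁, s₁) ∈ skewCells lam mu) (h₂ : (r₂, s₂) ∈ skewCells lam mu) (hr₁ : r₁ ≤ r)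
    (hr₂ : r ≤ r₂) (hs₁ : s₁ ≤ s) (hs₂ : s ≤ s₂) : (r, s) ∈ skewCells lam mu := by
  rw [skewCells, Finset.mem_sdiff, YoungDiagram.mem_cells, YoungDiagram.mem_cells] at *
  exact ⟨lam.up_left_mem hr₂ hs₂ h₂.1, fun h => h₁.2 (mu.up_left_mem hr₁ hs₁ h)⟩

theorem IsStandard.lt {lam mu : YoungDiagram} {N : ℕ} {T : skewCells lam mu ≃ Fin N}
    (hT : IsStandard T) {y z : skewCells lam mu} (h1 : y.val.1 < z.val.1)
    (h2 : y.val.2 < z.val.2) : T y < T z := by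
  obtain ⟨⟨r, s⟩, hy⟩ := y
  obtain ⟨⟨r', s'⟩, hz⟩ := z
  have hmid := skewCells_convex hy hz le_rfl h1.le h2.le le_rfl
  exact (hT.1 ⟨(r, s), hy⟩ ⟨(r, s'), hmid⟩ rfl h2).trans
    (hT.2 ⟨(r, s'), hmid⟩ ⟨(r', s'), hz⟩ rfl h1)

/-- A filling is standard if it increases between horizontally and vertically adjacent cells. -/
theorem IsStandard.of_adjacent {lam mu : YoungDiagram} {N : ℕ} {T : skewCells lam mu ≃ Fin N}
    (h1 : ∀ r s (h : (r, s) ∈ skewCells lam mu) (h' : (r, s + 1) ∈ skewCells lam mu),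
      T ⟨_, h⟩ < T ⟨_, h'⟩)
    (h2 : ∀ r s (h : (r, s) ∈ skewCells lam mu) (h' : (r + 1, s) ∈ skewCells lam mu),
      T ⟨_, h⟩ < T ⟨_, h'⟩) : IsStandard T := by
  constructor
  · rintro ⟨⟨r, s⟩, hy⟩ ⟨⟨r', s'⟩, hz⟩ (rfl : r = r') (hs : s < s')
    induction s', Nat.succ_le_of_lt hs using Nat.le_induction with
    | base => exact h1 r s hy hz
    | succ t ht ih =>
      have hmid := skewCells_convex hy hz le_rfl le_rfl ((Nat.le_succ s).trans ht) (Nat.le_succ t)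
      exact (ih hmid (Nat.lt_of_succ_le ht)).trans (h1 r t hmid hz)
  · rintro ⟨⟨r, s⟩, hy⟩ ⟨⟨r', s'⟩, hz⟩ (rfl : s = s') (hr : r < r')
    induction r', Nat.succ_le_of_lt hr using Nat.le_induction with
    | base => exact h2 r s hy hz
    | succ t ht ih =>
      have hmid := skewCells_convex hy hz ((Nat.le_succ r).trans ht) (Nat.le_succ t) le_rfl le_rfl
      exact (ih hmid (Nat.lt_of_succ_le ht)).trans (h2 t s hmid hz)

/-- The cells of `λ(S) / μ(S)`. -/
abbrev shapeCells (S : Finset ℤ) : Finset (ℕ × ℕ) := skewCells (lambdaDiagram S) (muDiagram S)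

/-- The level of a cell: the index of its diagonal, shifted by the number of negative elements. -/
def cellLevel (S : Finset ℤ) (y : ℕ × ℕ) : ℕ := (negElems S).length + y.2 - y.1

/-- The level function of a filling of `λ(S) / μ(S)`. -/
def fillingLevel {S : Finset ℤ} {N : ℕ} (T : shapeCells S ≃ Fin N) (c : Fin N) : ℕ :=
  cellLevel S (T.symm c).val

/-- The rows of the cells of level `k` with entry less than `x`. -/
def levelRows {S : Finset ℤ} {N : ℕ} (T : shapeCells S ≃ Fin N) (k x : ℕ) : Finset ℕ :=
  (Finset.univ.filter fun y : shapeCells S => (T y).val < x ∧ cellLevel S y.val = k).image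
    fun y => y.val.1

section

variable {S : Finset ℤ} {n N : ℕ} {T : shapeCells S ≃ Fin N}

theorem mem_shapeCells_iff {k r s : ℕ} (h : (negElems S).length + s = k + r) :
    (r, s) ∈ shapeCells S ↔ s < posCount S k ∧ (negElems S).length ≤ r + negCount S k := by
  rw [mem_skewCells_iff, show (negElems S).length + s - r = k by omega]
  constructor
  · exact fun h => h.2
  · exact fun h' => ⟨by omega, h'⟩

theorem cellLevel_add {y : ℕ × ℕ} (hy : y ∈ shapeCells S) :
    (negElems S).length + y.2 = cellLevel S y + y.1 := by
  have := ((mem_skewCells_iff S y.1 y.2).mp hy).1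
  unfold cellLevel
  omega

theorem mem_levelRows {k x r : ℕ} : r ∈ levelRows T k x ↔
    ∃ s, ∃ h : (r, s) ∈ shapeCells S, (T ⟨_, h⟩).val < x ∧ (negElems S).length + s = k + r := by
  simp only [levelRows, Finset.mem_image, Finset.mem_filter, Finset.mem_univ, true_and]
  constructor
  · rintro ⟨⟨⟨r, s⟩, h⟩, ⟨h1, h2⟩, rfl⟩
    exact ⟨s, h, h1, h2 ▸ cellLevel_add h⟩
  · rintro ⟨s, h, h1, h2⟩
    refine ⟨⟨(r, s), h⟩, ⟨h1, ?_⟩, rfl⟩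
    have := cellLevel_add h
    simp only at this ⊢
    omega

theorem card_levelRows (k x : ℕ) :
    (levelRows T k x).card = levelCount (fillingLevel T) k x := by
  rw [levelRows, Finset.card_image_of_injOn, levelCount]
  · refine Finset.card_equiv T fun y => ?_
    rw [Finset.mem_filter, Finset.mem_filter]
    simp [fillingLevel]
  · rintro ⟨⟨r, s⟩, hy⟩ h1 ⟨⟨r', s'⟩, hz⟩ h2 (rfl : r = r')
    simp only [Finset.coe_filter, Finset.mem_univ, true_and, Set.mem_ofPred_eq] at h1 h2
    have h3 := cellLevel_add hy
    have h4 := cellLevel_add hz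
    simp only at h3 h4
    have : s = s' := by omega
    subst this
    rfl

theorem IsBalanced.negCount_le_length (hS : IsBalanced S n) (k : ℕ) :
    negCount S k ≤ (negElems S).length := by
  rw [← hS.negCount_eq (max n k) (le_max_left _ _)]
  exact negCount_mono S (le_max_right _ _)

theorem IsBalanced.cellLevel_pos {y : ℕ × ℕ} (hy : y ∈ shapeCells S) : 1 ≤ cellLevel S y := by
  have h := (mem_shapeCells_iff (cellLevel_add hy)).mp hy
  by_contra h0
  rw [show cellLevel S y = 0 by omega, posCount_zero] at h
  omega

/-- At a level `k ≥ n` a cell would satisfy `s < n - u`, whereas `u + s = k + r ≥ n`. -/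
theorem IsBalanced.cellLevel_lt (hS : IsBalanced S n) {y : ℕ × ℕ} (hy : y ∈ shapeCells S) :
    cellLevel S y < n := by
  have h := (mem_shapeCells_iff (cellLevel_add hy)).mp hy
  have h1 := cellLevel_add hy
  by_contra h0
  have := hS.posCount_eq (cellLevel S y) (by omega)
  omega

theorem IsBalanced.levelCount_total (hS : IsBalanced S n) (T : shapeCells S ≃ Fin N) {k : ℕ}
    (hk : k ≤ n) : levelCount (fillingLevel T) k N + k = negCount S k + posCount S k := by
  have h1 := hS.le k hk
  have h2 := hS.negCount_le_length k
  have h3 := negCount_le S k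
  have : levelRows T k N = Finset.Ico ((negElems S).length - negCount S k)
      ((negElems S).length + posCount S k - k) := by
    ext r
    rw [mem_levelRows, Finset.mem_Ico]
    constructor
    · rintro ⟨s, h, -, hs⟩
      have := (mem_shapeCells_iff hs).mp h
      omega
    · intro hr
      have hs : (negElems S).length + (k + r - (negElems S).length) = k + r := by omega
      exact ⟨_, (mem_shapeCells_iff hs).mpr (by omega), (T _).isLt, hs⟩
  rw [← card_levelRows, this, Nat.card_Ico]
  omega

theorem IsBalanced.card_shapeCells (hS : IsBalanced S n) :
    (shapeCells S).card = ∑ k ∈ Finset.range n, (negCount S k + posCount S k - k) := by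
  rw [← sum_levelCount (fillingLevel (shapeCells S).equivFin) fun c => hS.cellLevel_lt
    ((shapeCells S).equivFin.symm c).2]
  refine Finset.sum_congr rfl fun k hk => ?_
  have := hS.levelCount_total (shapeCells S).equivFin (Finset.mem_range.mp hk).le
  omega

/-- The left neighbour of a cell of level `k + 1`, and the upper neighbour of a cell of level `k + 1
- 1 = k`, lie on the adjacent diagonal and carry smaller entries. Only the top cell of a diagonal
can lack such a neighbour in the shape, and `negInd S k` decides on which of the two diagonals this
happens. -/
theorem IsStandard.isLevelFunction (hS : IsBalanced S n) (hT : IsStandard T) :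
    IsLevelFunction S n (fillingLevel T) where
  pos c := IsBalanced.cellLevel_pos (T.symm c).2
  lt c := hS.cellLevel_lt (T.symm c).2
  total k hk := hS.levelCount_total T hk
  upper k hk x _ := by
    rw [← card_levelRows, ← card_levelRows]
    have h1 := negCount_succ S k
    have h2 := negInd_le_one S k
    have h3 := negCount_le S k
    have h5 := hS.negCount_le_length (k + 1)
    have h4 := posCount_succ S k
    have h6 := posInd_le_one S k
    -- Left neighbours stay in the same row. Diagonal `k + 1` starts `negInd S k` rows above
    -- diagonal `k`.
    have hsub : levelRows T (k + 1) x ⊆ levelRows T k x ∪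
        Finset.Ico ((negElems S).length - negCount S (k + 1))
          ((negElems S).length - negCount S k) := by
      intro r hr
      obtain ⟨s, h, hx, hs⟩ := mem_levelRows.mp hr
      have hmem := (mem_shapeCells_iff hs).mp h
      rw [Finset.mem_union, Finset.mem_Ico]
      by_cases hr' : (negElems S).length ≤ r + negCount S k
      · left
        obtain ⟨t, rfl⟩ : ∃ t, s = t + 1 := ⟨s - 1, by omega⟩
        have hs' : (negElems S).length + t = k + r := by omega
        have h' : (r, t) ∈ shapeCells S := (mem_shapeCells_iff hs').mpr (by omega)
        have := hT.1 ⟨_, h'⟩ ⟨_, h⟩ rfl (Nat.lt_succ_self t)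
        exact mem_levelRows.mpr ⟨t, h', (Fin.lt_def.mp this).trans hx, hs'⟩
      · right
        omega
    refine (Finset.card_le_card hsub).trans ((Finset.card_union_le _ _).trans ?_)
    rw [Nat.card_Ico]
    omega
  lower k hk x _ := by
    rw [← card_levelRows, ← card_levelRows]
    have h1 := negCount_succ S k
    have h2 := negInd_le_one S k
    have h3 := negCount_le S k
    have h5 := hS.negCount_le_length (k + 1)
    have h4 := posCount_succ S k
    -- Upper neighbours lie one row higher. The top cell of diagonal `k` lacks one precisely if both
    -- diagonals start in the same row.
    have hsub : levelRows T k x ⊆ (levelRows T (k + 1) x).image (· + 1) ∪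
        Finset.Ico ((negElems S).length - negCount S k)
          ((negElems S).length - negCount S k + (1 - negInd S k)) := by
      intro r hr
      obtain ⟨s, h, hx, hs⟩ := mem_levelRows.mp hr
      have hmem := (mem_shapeCells_iff hs).mp h
      rw [Finset.mem_union, Finset.mem_Ico]
      by_cases hr' : (negElems S).length + 1 ≤ r + negCount S (k + 1)
      · left
        obtain ⟨t, rfl⟩ : ∃ t, r = t + 1 := ⟨r - 1, by omega⟩
        have hs' : (negElems S).length + s = k + 1 + t := by omega
        have h' : (t, s) ∈ shapeCells S := (mem_shapeCells_iff hs').mpr (by omega)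
        have := hT.2 ⟨_, h'⟩ ⟨_, h⟩ rfl (Nat.lt_succ_self t)
        exact Finset.mem_image_of_mem _
          (mem_levelRows.mpr ⟨s, h', (Fin.lt_def.mp this).trans hx, hs'⟩)
      · right
        omega
    have := (Finset.card_le_card hsub).trans (Finset.card_union_le _ _)
    rw [Nat.card_Ico, Finset.card_image_of_injective _ (add_left_injective 1)] at this
    omega

/-- The row of a cell is determined by its level and the number of smaller entries in its
diagonal. -/
theorem IsStandard.levelCount_apply (hS : IsBalanced S n) (hT : IsStandard T) {k r s : ℕ}
    (h : (r, s) ∈ shapeCells S) (hs : (negElems S).length + s = k + r) :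
    levelCount (fillingLevel T) k (T ⟨_, h⟩) + (negElems S).length = r + negCount S k := by
  have hmem := (mem_shapeCells_iff hs).mp h
  have h2 := hS.negCount_le_length k
  have h3 := negCount_le S k
  have hlt : ∀ r' s' (h' : (r', s') ∈ shapeCells S), (negElems S).length + s' = k + r' →
      r' < r → T ⟨_, h'⟩ < T ⟨_, h⟩ := fun r' s' h' hs' hr => by
    have hs'' : s' < s := by omega
    exact hT.lt hr hs''
  have hgt : ∀ r' s' (h' : (r', s') ∈ shapeCells S), (negElems S).length + s' = k + r' →
      r < r' → T ⟨_, h⟩ < T ⟨_, h'⟩ := fun r' s' h' hs' hr => by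
    have hs'' : s < s' := by omega
    exact hT.lt hr hs''
  have : levelRows T k (T ⟨_, h⟩) = Finset.Ico ((negElems S).length - negCount S k) r := by
    ext r'
    rw [mem_levelRows, Finset.mem_Ico]
    constructor
    · rintro ⟨s', h', hx, hs'⟩
      have := (mem_shapeCells_iff hs').mp h'
      refine ⟨by omega, ?_⟩
      by_contra hr
      rcases (not_lt.mp hr).eq_or_lt with rfl | hr
      · have : s' = s := by omega
        subst this
        exact lt_irrefl _ hx
      · exact lt_asymm hx (Fin.lt_def.mp (hgt r' s' h' hs' hr))
    · intro hr
      have hs' : (negElems S).length + (k + r' - (negElems S).length) = k + r' := by omega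
      have h' : (r', _) ∈ shapeCells S := (mem_shapeCells_iff hs').mpr (by omega)
      exact ⟨_, h', Fin.lt_def.mp (hlt _ _ h' hs' hr.2), hs'⟩
  rw [← card_levelRows, this, Nat.card_Ico]
  omega

theorem IsStandard.symm_apply (hS : IsBalanced S n) (hT : IsStandard T) (c : Fin N) :
    (T.symm c).val.1 + negCount S (fillingLevel T c) =
      levelCount (fillingLevel T) (fillingLevel T c) c + (negElems S).length ∧
    (T.symm c).val.2 + (negElems S).length = fillingLevel T c + (T.symm c).val.1 := by
  have h1 := cellLevel_add (T.symm c).2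
  have h2 := hT.levelCount_apply hS (T.symm c).2 h1
  have h3 : T ⟨((T.symm c).val.1, (T.symm c).val.2), (T.symm c).2⟩ = c := T.apply_symm_apply c
  rw [h3] at h2
  exact ⟨h2.symm, by rw [add_comm]; exact h1⟩

/-- Entries increase down each diagonal, so the level of an entry and its rank within that level
determine its cell. -/
theorem fillingLevel_injective (hS : IsBalanced S n) {T' : shapeCells S ≃ Fin N}
    (hT : IsStandard T) (hT' : IsStandard T') (h : fillingLevel T = fillingLevel T') : T = T' := by
  have : T.symm = T'.symm := by
    ext c : 1
    have h1 := hT.symm_apply hS c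
    have h2 := hT'.symm_apply hS c
    rw [← h] at h2
    exact Subtype.ext (Prod.ext (by omega) (by omega))
  rw [← T.symm_symm, this, T'.symm_symm]

/-- The cell that carries the entry `c` in the tableau with level function `f`. -/
def levelCell (S : Finset ℤ) {N : ℕ} (f : Fin N → ℕ) (c : Fin N) : ℕ × ℕ :=
  (levelCount f (f c) c + ((negElems S).length - negCount S (f c)),
    levelCount f (f c) c + (f c - negCount S (f c)))

theorem levelCell_level (hS : IsBalanced S n) (f : Fin N → ℕ) (c : Fin N) :
    (negElems S).length + (levelCell S f c).2 = f c + (levelCell S f c).1 := by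
  have h1 := hS.negCount_le_length (f c)
  have h2 := negCount_le S (f c)
  simp only [levelCell]
  omega

theorem levelCell_mem (hS : IsBalanced S n) {f : Fin N → ℕ} (hf : IsLevelFunction S n f)
    (c : Fin N) : levelCell S f c ∈ shapeCells S := by
  have h1 := hS.negCount_le_length (f c)
  have h2 := negCount_le S (f c)
  have h3 := hf.total (f c) (hf.lt c).le
  have h4 := levelCount_lt_of_le f c c.isLt
  refine (mem_shapeCells_iff (levelCell_level hS f c)).mpr ?_
  simp only [levelCell]
  omega

theorem levelCell_injective (hS : IsBalanced S n) (f : Fin N → ℕ) :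
    Function.Injective (levelCell S f) := by
  intro c d hcd
  have h1 := levelCell_level hS f c
  have h2 := levelCell_level hS f d
  rw [hcd] at h1
  have hlev : f c = f d := by omega
  have h3 := congrArg Prod.fst hcd
  simp only [levelCell, hlev] at h3
  rcases lt_trichotomy c.val d.val with h | h | h
  · have := levelCount_lt_of_le f c h
    rw [hlev] at this
    omega
  · exact Fin.ext h
  · have := levelCount_lt_of_le f d h
    omega

/-- Placing each entry on its diagonal according to its rank is injective, hence bijective by
counting. Interlacing then orders adjacent cells, which suffices for standardness. -/
theorem exists_fillingLevel_eq (hS : IsBalanced S n) (hN : (shapeCells S).card = N)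
    {f : Fin N → ℕ} (hf : IsLevelFunction S n f) :
    ∃ T : shapeCells S ≃ Fin N, IsStandard T ∧ fillingLevel T = f := by
  let g : Fin N → shapeCells S := fun c => ⟨levelCell S f c, levelCell_mem hS hf c⟩
  have hg : Function.Bijective g := by
    rw [Fintype.bijective_iff_injective_and_card]
    refine ⟨fun c d h => levelCell_injective hS f (congrArg Subtype.val h), ?_⟩
    rw [Fintype.card_fin, Fintype.card_coe, hN]
  let e := Equiv.ofBijective g hg
  have he : ∀ y (h : y ∈ shapeCells S), levelCell S f (e.symm ⟨y, h⟩) = y := fun y h =>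
    congrArg Subtype.val (e.apply_symm_apply ⟨y, h⟩)
  refine ⟨e.symm, IsStandard.of_adjacent ?_ ?_, ?_⟩
  · intro r s h h'
    set c := e.symm ⟨_, h⟩ with hc
    set d := e.symm ⟨_, h'⟩ with hd
    have hc' := he _ h
    have hd' := he _ h'
    rw [← hc] at hc'
    rw [← hd] at hd'
    have h1 := levelCell_level hS f c
    have h2 := levelCell_level hS f d
    rw [hc'] at h1
    rw [hd'] at h2
    simp only at h1 h2
    have hk : f d = f c + 1 := by omega
    have h3 := hS.negCount_le_length (f c)
    have h4 := hS.negCount_le_length (f d)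
    have h5 := congrArg Prod.fst hc'
    have h6 := congrArg Prod.fst hd'
    simp only [levelCell] at h5 h6
    have h7 := negCount_succ S (f c)
    rw [← hk] at h7
    -- Being in one row means `rank d = rank c + negInd`. If `d < c`, then `upper` at `d + 1` gives
    -- `rank d + 1 ≤ rank c + negInd`.
    by_contra hcon
    have hne : c.val ≠ d.val := fun h => by
      rw [Fin.ext h] at hk
      omega
    have hlt : d.val + 1 ≤ c.val := by
      have := not_lt.mp hcon
      rw [Fin.le_def] at this
      omega
    have h8 := hf.upper (f c) (hf.lt c) (d + 1) d.isLt
    rw [← hk, levelCount_succ_self] at h8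
    have h9 := levelCount_mono f (f c) hlt
    omega
  · intro r s h h'
    set c := e.symm ⟨_, h⟩ with hc
    set d := e.symm ⟨_, h'⟩ with hd
    have hc' := he _ h
    have hd' := he _ h'
    rw [← hc] at hc'
    rw [← hd] at hd'
    have h1 := levelCell_level hS f c
    have h2 := levelCell_level hS f d
    rw [hc'] at h1
    rw [hd'] at h2
    simp only at h1 h2
    have hk : f c = f d + 1 := by omega
    have h3 := hS.negCount_le_length (f c)
    have h4 := hS.negCount_le_length (f d)
    have h5 := congrArg Prod.fst hc'
    have h6 := congrArg Prod.fst hd'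
    simp only [levelCell] at h5 h6
    have h7 := negCount_succ S (f d)
    rw [← hk] at h7
    -- Here `rank d + negInd = rank c + 1`, and `d < c` would contradict `lower` at `d + 1`.
    by_contra hcon
    have hne : c.val ≠ d.val := fun h => by
      rw [Fin.ext h] at hk
      omega
    have hlt : d.val + 1 ≤ c.val := by
      have := not_lt.mp hcon
      rw [Fin.le_def] at this
      omega
    have h8 := hf.lower (f d) (hf.lt d) (d + 1) d.isLt
    rw [← hk, levelCount_succ_self] at h8
    have h9 := levelCount_mono f (f c) hlt
    omega
  · funext c
    have h1 := levelCell_level hS f c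
    have h2 := cellLevel_add (levelCell_mem hS hf c)
    change cellLevel S (levelCell S f c) = f c
    omega

/-- Standard Young tableaux of shape `λ(S) / μ(S)` correspond to level functions. -/
theorem numSkewSYT_eq_card (hS : IsBalanced S n) (hN : (shapeCells S).card = N) :
    numSkewSYT (lambdaDiagram S) (muDiagram S) =
      Nat.card {f : Fin N → ℕ // IsLevelFunction S n f} := by
  subst hN
  refine Nat.card_congr (Equiv.ofBijective
    (fun T => ⟨fillingLevel T.1, IsStandard.isLevelFunction hS T.2⟩) ⟨fun T T' h => ?_, ?_⟩)
  · exact Subtype.ext (fillingLevel_injective hS T.2 T'.2 (congrArg Subtype.val h))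
  · rintro ⟨f, hf⟩
    obtain ⟨T, hT, h⟩ := exists_fillingLevel_eq hS rfl hf
    exact ⟨⟨T, hT⟩, Subtype.ext h⟩

end

/-! ### Full trapezoids and level functions -/

namespace ASTrapezoid

variable {n l : ℕ}

theorem tailSum_nonneg (A : ASTrapezoid n l) (k : ℕ) (j : ℤ) : 0 ≤ A.tailSum k j := by
  rcases A.tailSum_mem k j with h | h <;> omega

theorem tailSum_eq_of_forall (A : ASTrapezoid n l) {k : ℕ} {j : ℤ}
    (h : ∀ i : Fin n, i.val < k → A.entry i j = 0) : A.tailSum k j = A.tailSum 0 j := by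
  rw [tailSum, tailSum, Finset.filter_true_of_mem fun i _ => Nat.zero_le _]
  refine Finset.sum_subset (Finset.filter_subset _ _) fun i _ hi => h i ?_
  simpa using hi

/-- Column `-k` has its lowest cell in the row of index `k`, so this tail sum is the whole column
sum. -/
theorem tailSum_left (A : ASTrapezoid n l) (hl : 1 ≤ l) (k : ℕ) :
    A.tailSum k (-(k : ℤ)) = negInd A.catalanSet k := by
  rw [A.tailSum_eq_of_forall fun i hi => A.outside i _ (by rw [Finset.mem_Icc]; omega), negInd]
  have h := A.tailSum_mem 0 (-(k : ℤ))
  have hm := A.mem_catalanSet hl (-((k : ℤ) + 1))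
  rw [show -((k : ℤ) + 1) + 1 = -k by ring] at hm
  split_ifs with hx <;> rw [hm] at hx <;> push_cast <;> omega

theorem tailSum_right (A : ASTrapezoid n l) (hl : 1 ≤ l) (k : ℕ) :
    A.tailSum k ((l : ℤ) + k) = posInd A.catalanSet k := by
  rw [A.tailSum_eq_of_forall fun i hi => A.outside i _ (by rw [Finset.mem_Icc]; omega), posInd]
  have h := A.tailSum_mem 0 ((l : ℤ) + k)
  have hm := A.mem_catalanSet hl ((k : ℤ) + 1)
  rw [show (k : ℤ) + 1 + ((l : ℤ) - 1) = l + k by ring] at hm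
  split_ifs with hx <;> rw [hm] at hx <;> push_cast <;> omega

theorem catalanSet_subset (A : ASTrapezoid n l) (hl : 1 ≤ l) :
    A.catalanSet ⊆ Finset.Icc (-(n : ℤ)) n := by
  have hzero : ∀ j, 0 < A.tailSum 0 j → -(n : ℤ) + 1 ≤ j ∧ j ≤ (l : ℤ) + n - 1 := by
    intro j hj
    by_contra hcon
    rw [tailSum_zero, Finset.sum_eq_zero] at hj
    · exact lt_irrefl _ hj
    · intro i _
      refine A.outside i j ?_
      have := i.isLt
      simp only [Finset.mem_Icc]
      omega
  intro x hx
  rw [Finset.mem_Icc]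
  rcases (A.mem_catalanSet hl x).mp hx with h | ⟨h, hj⟩ | ⟨h, hj⟩
  · omega
  · have := hzero _ hj; omega
  · have := hzero _ hj; omega

/-- The sum of the partial column sums above level `k` over the columns that meet the lowest `k`
rows. -/
noncomputable def rangeSum (A : ASTrapezoid n l) (k : ℕ) : ℤ :=
  ∑ j ∈ Finset.Icc (-(k : ℤ) + 1) ((l : ℤ) + k - 1), A.tailSum k j

/-- Passing from `k` to `k + 1` adds the two outer columns, which contribute `negInd + posInd`, and
removes row `k`, of sum `1`. At `k = 0` only the central columns occur, with sum `0`. -/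
theorem rangeSum_add (A : ASTrapezoid n l) (hl : 1 ≤ l) {k : ℕ} (hk : k ≤ n) :
    A.rangeSum k + k = negCount A.catalanSet k + posCount A.catalanSet k := by
  induction k with
  | zero =>
    rw [negCount_zero, posCount_zero, rangeSum, Finset.sum_eq_zero]
    · simp
    · intro j hj
      rw [Finset.mem_Icc] at hj
      rw [tailSum_zero]
      exact A.central_col_sum j (by simpa using hj.1) (by simpa using hj.2)
  | succ k ih =>
    have ih := ih (by omega)
    have hrow := A.row_sum ⟨k, hk⟩
    simp only at hrow
    have h1 : A.rangeSum (k + 1) =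
        ∑ j ∈ Finset.Icc (-(k : ℤ)) ((l : ℤ) + k), A.tailSum k j - 1 := by
      rw [← hrow, ← Finset.sum_sub_distrib, rangeSum]
      refine Finset.sum_congr (by congr 1 <;> push_cast <;> ring) fun j _ => ?_
      have := A.tailSum_eq_add ⟨k, hk⟩ j
      simp only at this
      omega
    have h2 : Finset.Icc (-(k : ℤ)) ((l : ℤ) + k) =
        insert (-(k : ℤ)) (insert ((l : ℤ) + k)
          (Finset.Icc (-(k : ℤ) + 1) ((l : ℤ) + k - 1))) := by
      ext j
      simp only [Finset.mem_Icc, Finset.mem_insert]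
      omega
    rw [h2, Finset.sum_insert (by simp only [Finset.mem_insert, Finset.mem_Icc]; omega),
      Finset.sum_insert (by simp), A.tailSum_left hl, A.tailSum_right hl] at h1
    rw [h1, negCount_succ, posCount_succ]
    rw [rangeSum] at ih
    push_cast
    linarith

theorem sum_central_le_rangeSum (A : ASTrapezoid n l) (k : ℕ) :
    ∑ j ∈ Finset.Icc 1 ((l : ℤ) - 1), A.tailSum k j ≤ A.rangeSum k :=
  Finset.sum_le_sum_of_subset_of_nonneg (Finset.Icc_subset_Icc (by omega) (by omega))
    fun j _ _ => A.tailSum_nonneg k j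

/-- A non-zero entry is the difference of two consecutive tail sums, so one of them is `1`. -/
theorem IsFull.one_le_sum {A : ASTrapezoid n l} (hA : A.IsFull) {j : ℤ}
    (hj : j ∈ Finset.Icc 1 ((l : ℤ) - 1)) : 1 ≤ ∑ k ∈ Finset.range (n + 1), A.tailSum k j := by
  rw [Finset.mem_Icc] at hj
  obtain ⟨i, hi⟩ := hA j hj.1 hj.2
  have h1 := A.tailSum_eq_add i j
  have hsingle : ∀ k ≤ n, A.tailSum k j ≤ ∑ k ∈ Finset.range (n + 1), A.tailSum k j := fun k hk =>
    Finset.single_le_sum (f := fun k => A.tailSum k j) (fun k _ => A.tailSum_nonneg k j)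
      (Finset.mem_range.mpr (by omega))
  have h2 := hsingle i i.isLt.le
  have h3 := hsingle (i + 1) i.isLt
  rcases A.tailSum_mem i j with h | h <;> rcases A.tailSum_mem (i + 1) j with h' | h' <;> omega

theorem IsFull.card_le_sum {A : ASTrapezoid n l} (hA : A.IsFull) :
    ((Finset.Icc 1 ((l : ℤ) - 1)).card : ℤ) ≤
      ∑ j ∈ Finset.Icc 1 ((l : ℤ) - 1), ∑ k ∈ Finset.range (n + 1), A.tailSum k j := by
  have := Finset.sum_le_sum fun j hj => hA.one_le_sum (j := j) hj
  simpa using this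

/-- The number of central columns of a full trapezoid is at most the area of its path. -/
theorem IsFull.le_sum_rangeSum {N : ℕ} {A : ASTrapezoid n (N + 1)} (hA : A.IsFull) :
    (N : ℤ) ≤ ∑ k ∈ Finset.range (n + 1), A.rangeSum k := by
  have h1 := hA.card_le_sum
  rw [Finset.sum_comm] at h1
  have h2 := Finset.sum_le_sum fun k (_ : k ∈ Finset.range (n + 1)) =>
    A.sum_central_le_rangeSum k
  rw [Int.card_Icc] at h1
  push_cast at h1 h2
  omega

/-! ### Equality in the area bound -/

section Extremal

variable {N : ℕ} {A : ASTrapezoid n (N + 1)}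

theorem IsFull.sum_tailSum_eq_one (hA : A.IsFull)
    (hN : ∑ k ∈ Finset.range (n + 1), A.rangeSum k = N) (c : Fin N) :
    ∑ k ∈ Finset.range (n + 1), A.tailSum k ((c.val : ℤ) + 1) = 1 := by
  have h1 := hA.card_le_sum
  have h2 := Finset.sum_le_sum fun k (_ : k ∈ Finset.range (n + 1)) =>
    A.sum_central_le_rangeSum k
  rw [Finset.sum_comm] at h2
  have h3 : ∑ j ∈ Finset.Icc 1 (((N + 1 : ℕ) : ℤ) - 1), (1 : ℤ) =
      ∑ j ∈ Finset.Icc 1 (((N + 1 : ℕ) : ℤ) - 1),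
        ∑ k ∈ Finset.range (n + 1), A.tailSum k j := by
    refine le_antisymm (by simpa using h1) (h2.trans ?_)
    rw [hN]
    simp
  rw [Finset.sum_eq_sum_iff_of_le fun j hj => hA.one_le_sum hj] at h3
  exact (h3 _ (by rw [Finset.mem_Icc]; push_cast; omega)).symm

/-- The central columns already exhaust the total of the range sums, so non-negativity leaves
nothing for the other columns in range. -/
theorem IsFull.tailSum_eq_zero (hA : A.IsFull)
    (hN : ∑ k ∈ Finset.range (n + 1), A.rangeSum k = N) {k : ℕ} (hk : k ≤ n) {j : ℤ}
    (hj : j ∈ Finset.Icc (-(k : ℤ) + 1) (((N + 1 : ℕ) : ℤ) + k - 1)) (hj' : j ≤ 0 ∨ (N : ℤ) < j) :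
    A.tailSum k j = 0 := by
  have h1 := hA.card_le_sum
  rw [Finset.sum_comm, Int.card_Icc] at h1
  have h2 : ∑ k ∈ Finset.range (n + 1), ∑ j ∈ Finset.Icc 1 (((N + 1 : ℕ) : ℤ) - 1), A.tailSum k j =
      ∑ k ∈ Finset.range (n + 1), A.rangeSum k := by
    refine le_antisymm (Finset.sum_le_sum fun k _ => A.sum_central_le_rangeSum k) ?_
    rw [hN]
    push_cast at h1 ⊢
    omega
  rw [Finset.sum_eq_sum_iff_of_le fun k _ => A.sum_central_le_rangeSum k] at h2
  have h3 := h2 k (Finset.mem_range.mpr (by omega))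
  have hsub : insert j (Finset.Icc 1 (((N + 1 : ℕ) : ℤ) - 1)) ⊆
      Finset.Icc (-(k : ℤ) + 1) (((N + 1 : ℕ) : ℤ) + k - 1) :=
    Finset.insert_subset hj (Finset.Icc_subset_Icc (by omega) (by omega))
  have h4 := Finset.sum_le_sum_of_subset_of_nonneg hsub fun j _ _ => A.tailSum_nonneg k j
  rw [Finset.sum_insert (by rw [Finset.mem_Icc]; push_cast; omega), h3, rangeSum] at h4
  have := A.tailSum_nonneg k j
  omega

theorem IsFull.exists_level (hA : A.IsFull)
    (hN : ∑ k ∈ Finset.range (n + 1), A.rangeSum k = N) :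
    ∃ f : Fin N → ℕ, (∀ c, 1 ≤ f c ∧ f c < n) ∧
      ∀ k c, A.tailSum k ((c.val : ℤ) + 1) = if f c = k then 1 else 0 := by
  have h : ∀ c : Fin N, ∃ k, (1 ≤ k ∧ k < n) ∧
      ∀ k', A.tailSum k' ((c.val : ℤ) + 1) = if k = k' then 1 else 0 := by
    intro c
    have hsum := hA.sum_tailSum_eq_one hN c
    obtain ⟨k, hk, hk0⟩ := Finset.exists_ne_zero_of_sum_ne_zero (by rw [hsum]; exact one_ne_zero)
    have hk1 : A.tailSum k ((c.val : ℤ) + 1) = 1 := (A.tailSum_mem k _).resolve_left hk0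
    have hzero : A.tailSum 0 ((c.val : ℤ) + 1) = 0 := by
      rw [tailSum_zero]
      exact A.central_col_sum _ (by omega) (by push_cast; omega)
    refine ⟨k, ⟨?_, ?_⟩, fun k' => ?_⟩
    · by_contra h
      rw [show k = 0 by omega] at hk0
      exact hk0 hzero
    · by_contra h
      exact hk0 (A.tailSum_eq_zero_of_le (by omega) _)
    · split_ifs with h
      · rw [← h, hk1]
      · by_cases hk' : k' < n + 1
        · rw [← Finset.add_sum_erase _ _ hk, hk1] at hsum
          have h0 : ∑ x ∈ (Finset.range (n + 1)).erase k, A.tailSum x ((c.val : ℤ) + 1) = 0 := by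
            linarith
          rw [Finset.sum_eq_zero_iff_of_nonneg fun x _ => A.tailSum_nonneg x _] at h0
          exact h0 k' (Finset.mem_erase.mpr ⟨Ne.symm h, Finset.mem_range.mpr hk'⟩)
        · exact A.tailSum_eq_zero_of_le (by omega) _
  choose f hf using h
  exact ⟨f, fun c => (hf c).1, fun k c => (hf c).2 k⟩

end Extremal

end ASTrapezoid

/-- The entries of the trapezoid with centred Catalan set `S` and level function `f`. -/
def levelEntry (S : Finset ℤ) {N : ℕ} (f : Fin N → ℕ) (i : ℕ) (j : ℤ) : ℤ :=
  (if j = -(i : ℤ) then (negInd S i : ℤ) else 0) +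
    (if j = (N : ℤ) + 1 + i then (posInd S i : ℤ) else 0) +
    ∑ c : Fin N, if (c.val : ℤ) + 1 = j then
      ((if f c = i then 1 else 0) - (if f c = i + 1 then 1 else 0)) else 0

/-! ### The trapezoid attached to a level function -/

section

variable {S : Finset ℤ} {n N : ℕ}

theorem levelEntry_central (S : Finset ℤ) (f : Fin N → ℕ) (i : ℕ) (c : Fin N) :
    levelEntry S f i ((c.val : ℤ) + 1) =
      (if f c = i then 1 else 0) - (if f c = i + 1 then 1 else 0) := by
  rw [levelEntry, if_neg (by omega), if_neg (by omega), Finset.sum_eq_single c]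
  · simp
  · intro d _ hd
    rw [if_neg]
    intro h
    exact hd (Fin.ext (by omega))
  · simp

theorem levelEntry_left (S : Finset ℤ) (f : Fin N → ℕ) (i : ℕ) {j : ℤ} (hj : j ≤ 0) :
    levelEntry S f i j = if j = -(i : ℤ) then (negInd S i : ℤ) else 0 := by
  rw [levelEntry, if_neg (c := j = (N : ℤ) + 1 + i) (by omega), Finset.sum_eq_zero]
  · simp
  · intro c _
    rw [if_neg (by omega)]

theorem levelEntry_right (S : Finset ℤ) (f : Fin N → ℕ) (i : ℕ) {j : ℤ} (hj : (N : ℤ) < j) :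
    levelEntry S f i j = if j = (N : ℤ) + 1 + i then (posInd S i : ℤ) else 0 := by
  rw [levelEntry, if_neg (c := j = -(i : ℤ)) (by omega), Finset.sum_eq_zero]
  · simp
  · intro c _
    rw [if_neg (by omega)]

theorem exists_fin_of_mem {N : ℕ} {j : ℤ} (h1 : 1 ≤ j) (h2 : j ≤ N) :
    ∃ c : Fin N, j = (c.val : ℤ) + 1 :=
  ⟨⟨(j - 1).toNat, by omega⟩, by simp only; omega⟩

/-- This translates row sums into level counts. Position `c` has label `c + 1`, so the labels up to
`x` are the positions below `x`; `toNat` makes negative `x` count none. -/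
theorem sum_levelEntry (S : Finset ℤ) (f : Fin N → ℕ) (i : ℕ) (x : ℤ) :
    ∑ j ∈ Finset.Icc (-(i : ℤ)) x, levelEntry S f i j =
      (if -(i : ℤ) ≤ x then (negInd S i : ℤ) else 0) +
        (if (N : ℤ) + 1 + i ≤ x then (posInd S i : ℤ) else 0) +
        (levelCount f i x.toNat - levelCount f (i + 1) x.toNat) := by
  simp only [levelEntry, Finset.sum_add_distrib]
  rw [Finset.sum_comm]
  congr 1
  · congr 1
    · rw [Finset.sum_ite_eq']
      exact if_congr (by rw [Finset.mem_Icc]; omega) rfl rfl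
    · rw [Finset.sum_ite_eq']
      exact if_congr (by rw [Finset.mem_Icc]; omega) rfl rfl
  · have hcount : ∀ k, (levelCount f k x.toNat : ℤ) =
        ∑ c : Fin N, if (c.val : ℤ) + 1 ∈ Finset.Icc (-(i : ℤ)) x then
          (if f c = k then 1 else 0) else 0 := by
      intro k
      rw [levelCount, Finset.card_filter]
      push_cast
      refine Finset.sum_congr rfl fun c _ => ?_
      rw [← ite_and]
      exact if_congr (and_congr_left' (by rw [Finset.mem_Icc]; omega)) rfl rfl
    rw [hcount, hcount, ← Finset.sum_sub_distrib]
    refine Finset.sum_congr rfl fun c _ => ?_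
    rw [Finset.sum_ite_eq]
    split_ifs <;> simp

theorem levelCount_of_le (f : Fin N → ℕ) (k : ℕ) {x : ℕ} (hx : N ≤ x) :
    levelCount f k x = levelCount f k N := by
  unfold levelCount
  congr 1
  refine Finset.filter_congr fun c _ => ?_
  have := c.isLt
  exact and_congr_left' (by omega)

theorem IsLevelFunction.sum_levelEntry_eq_one {f : Fin N → ℕ} (hf : IsLevelFunction S n f) {i : ℕ}
    (hi : i < n) {x : ℤ} (hx : (N : ℤ) + 1 + i ≤ x) :
    ∑ j ∈ Finset.Icc (-(i : ℤ)) x, levelEntry S f i j = 1 := by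
  rw [sum_levelEntry, if_pos (by omega), if_pos hx, levelCount_of_le f i (by omega),
    levelCount_of_le f (i + 1) (by omega)]
  have h1 := hf.total i hi.le
  have h2 := hf.total (i + 1) hi
  rw [negCount_succ, posCount_succ] at h2
  omega

/-- Before the right end is reached, `upper` says that the partial sum is at least `0` and `lower`
that it is at most `1`. -/
theorem IsLevelFunction.sum_levelEntry_mem {f : Fin N → ℕ} (hf : IsLevelFunction S n f) {i : ℕ}
    (hi : i < n) (x : ℤ) :
    ∑ j ∈ Finset.Icc (-(i : ℤ)) x, levelEntry S f i j = 0 ∨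
      ∑ j ∈ Finset.Icc (-(i : ℤ)) x, levelEntry S f i j = 1 := by
  by_cases h1 : (N : ℤ) + 1 + i ≤ x
  · exact Or.inr (hf.sum_levelEntry_eq_one hi h1)
  by_cases h2 : x < -(i : ℤ)
  · left
    rw [Finset.Icc_eq_empty (by omega), Finset.sum_empty]
  rw [sum_levelEntry, if_pos (by omega), if_neg h1]
  by_cases hx : x.toNat ≤ N
  · have h3 := hf.upper i hi x.toNat hx
    have h4 := hf.lower i hi x.toNat hx
    omega
  · rw [levelCount_of_le f i (by omega), levelCount_of_le f (i + 1) (by omega)]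
    have h3 := hf.upper i hi N le_rfl
    have h4 := hf.lower i hi N le_rfl
    omega

theorem IsLevelFunction.alternating_levelEntry {f : Fin N → ℕ} (hf : IsLevelFunction S n f) {i : ℕ}
    (hi : i < n) : Alternating (levelEntry S f i) ∧
      ∀ j, levelEntry S f i j = 1 ∨ levelEntry S f i j = 0 ∨ levelEntry S f i j = -1 :=
  Alternating.of_sum_Icc (-(i : ℤ))
    (fun j hj => by rw [levelEntry_left S f i (by omega), if_neg (by omega)])
    (hf.sum_levelEntry_mem hi)

/-- The full trapezoid with centred Catalan set `S` and level function `f`. -/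
def IsLevelFunction.toTrapezoid {f : Fin N → ℕ} (hf : IsLevelFunction S n f) :
    ASTrapezoid n (N + 1) where
  entry i := levelEntry S f i
  entry_mem i := (hf.alternating_levelEntry i.isLt).2
  outside i j hj := by
    rw [Finset.mem_Icc] at hj
    push_cast at hj
    by_cases h : j ≤ 0
    · rw [levelEntry_left S f i h, if_neg (by omega)]
    · rw [levelEntry_right S f i (by omega), if_neg (by omega)]
  row_sum i := hf.sum_levelEntry_eq_one i.isLt (by push_cast; omega)
  central_col_sum j h1 h2 := by
    obtain ⟨c, rfl⟩ := exists_fin_of_mem (N := N) h1 (by push_cast at h2; omega)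
    simp only [levelEntry_central, Finset.sum_sub_distrib]
    have hp := hf.pos c
    have hl := hf.lt c
    -- The column holds `1` in row `f c` and `-1` in row `f c - 1`; both rows exist because `1 ≤ f c
    -- < n`.
    rw [Finset.sum_eq_single (⟨f c, hl⟩ : Fin n), Finset.sum_eq_single (⟨f c - 1, by omega⟩ : Fin n)]
    · rw [if_pos rfl, if_pos (by simp only; omega), sub_self]
    · intro b _ hb
      rw [if_neg fun h => hb (Fin.ext (by simp only; omega))]
    · simp
    · intro b _ hb
      rw [if_neg fun h => hb (Fin.ext (by simp only; omega))]
    · simp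
  row_alternating i := (hf.alternating_levelEntry i.isLt).1
  col_alternating j := by
    intro a b hab ha hb hc
    rw [Fin.lt_def] at hab
    simp only at ha hb ⊢
    by_cases h0 : j ≤ 0
    · rw [levelEntry_left S f _ h0] at ha hb
      have h1 := (ite_ne_right_iff.mp ha).1
      have h2 := (ite_ne_right_iff.mp hb).1
      omega
    · by_cases h1 : j ≤ N
      · obtain ⟨c, rfl⟩ := exists_fin_of_mem (by omega) h1
        rw [levelEntry_central] at ha hb ⊢
        rw [levelEntry_central]
        split_ifs at ha hb ⊢ <;> omega
      · rw [levelEntry_right S f _ (by omega)] at ha hb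
        have h1 := (ite_ne_right_iff.mp ha).1
        have h2 := (ite_ne_right_iff.mp hb).1
        omega
  col_top_pos i j hi htop := by
    by_cases h0 : j ≤ 0
    · rw [levelEntry_left S f _ h0] at hi ⊢
      split_ifs at hi ⊢ <;> omega
    · by_cases h1 : j ≤ N
      · obtain ⟨c, rfl⟩ := exists_fin_of_mem (by omega) h1
        rw [levelEntry_central] at hi ⊢
        -- An entry `-1` has a `1` directly above it, so it is never the top non-zero entry.
        by_cases hc : f c = i.val + 1
        · have := htop ⟨i.val + 1, hc ▸ hf.lt c⟩ (Fin.lt_def.mpr (Nat.lt_succ_self _))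
          rw [levelEntry_central] at this
          simp only at this
          rw [if_pos hc, if_neg (by omega)] at this
          omega
        · rw [if_neg hc] at hi ⊢
          split_ifs at hi ⊢ <;> omega
      · rw [levelEntry_right S f _ (by omega)] at hi ⊢
        split_ifs at hi ⊢ <;> omega

theorem IsLevelFunction.isFull_toTrapezoid {f : Fin N → ℕ} (hf : IsLevelFunction S n f) :
    hf.toTrapezoid.IsFull := by
  intro j h1 h2
  obtain ⟨c, rfl⟩ := exists_fin_of_mem (N := N) h1 (by push_cast at h2; omega)
  refine ⟨⟨f c, hf.lt c⟩, ?_⟩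
  change levelEntry S f (f c) _ ≠ 0
  rw [levelEntry_central]
  simp

theorem IsLevelFunction.catalanSet_toTrapezoid {f : Fin N → ℕ} (hf : IsLevelFunction S n f)
    (h0 : 0 ∈ S) (hS : S ⊆ Finset.Icc (-(n : ℤ)) n) : hf.toTrapezoid.catalanSet = S := by
  ext x
  rw [ASTrapezoid.mem_catalanSet _ (by omega), ASTrapezoid.tailSum_zero, ASTrapezoid.tailSum_zero]
  have hleft : x < 0 → (0 < ∑ i, hf.toTrapezoid.entry i (x + 1) ↔ x ∈ S) := by
    intro hx
    have hentry : ∀ i : Fin n, hf.toTrapezoid.entry i (x + 1) =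
        if x + 1 = -(i.val : ℤ) then (negInd S i : ℤ) else 0 :=
      fun i => levelEntry_left S f i (by omega)
    simp only [hentry]
    rw [Finset.sum_pos_iff_of_nonneg fun i _ => by split_ifs <;> omega]
    constructor
    · rintro ⟨i, -, hi⟩
      by_cases h : x + 1 = -(i.val : ℤ)
      · rw [if_pos h, negInd] at hi
        by_contra hxS
        rw [if_neg (by rwa [show -((i.val : ℤ) + 1) = x by omega])] at hi
        simp at hi
      · simp [h] at hi
    · intro hxS
      have := Finset.mem_Icc.mp (hS hxS)
      refine ⟨⟨(-x - 1).toNat, by omega⟩, Finset.mem_univ _, ?_⟩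
      rw [if_pos (by simp only; omega), negInd, if_pos]
      · simp
      · rwa [show -(((-x - 1).toNat : ℤ) + 1) = x by omega]
  have hright : 0 < x →
      (0 < ∑ i, hf.toTrapezoid.entry i (x + (((N + 1 : ℕ) : ℤ) - 1)) ↔ x ∈ S) := by
    intro hx
    have hentry : ∀ i : Fin n, hf.toTrapezoid.entry i (x + (((N + 1 : ℕ) : ℤ) - 1)) =
        if x + (((N + 1 : ℕ) : ℤ) - 1) = (N : ℤ) + 1 + i.val then (posInd S i : ℤ) else 0 :=
      fun i => levelEntry_right S f i (by push_cast; omega)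
    simp only [hentry]
    rw [Finset.sum_pos_iff_of_nonneg fun i _ => by split_ifs <;> omega]
    constructor
    · rintro ⟨i, -, hi⟩
      by_cases h : x + (((N + 1 : ℕ) : ℤ) - 1) = (N : ℤ) + 1 + i.val
      · rw [if_pos h, posInd] at hi
        by_contra hxS
        rw [if_neg (by rwa [show (i.val : ℤ) + 1 = x by push_cast at h; omega])] at hi
        simp at hi
      · rw [if_neg h] at hi
        exact absurd hi (lt_irrefl _)
    · intro hxS
      have := Finset.mem_Icc.mp (hS hxS)
      refine ⟨⟨(x - 1).toNat, by omega⟩, Finset.mem_univ _, ?_⟩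
      rw [if_pos (by simp only; push_cast; omega), posInd, if_pos]
      · simp
      · rwa [show ((x - 1).toNat : ℤ) + 1 = x by omega]
  rcases lt_trichotomy x 0 with hx | hx | hx
  · rw [← hleft hx]
    omega
  · simp [hx, h0]
  · rw [← hright hx]
    omega

/-- Every entry is a difference of consecutive tail sums, and in the extremal case all of these are
fixed by `f` and `S`. -/
theorem exists_toTrapezoid_eq {A : ASTrapezoid n (N + 1)} (hA : A.IsFull)
    (hN : ∑ k ∈ Finset.range (n + 1), A.rangeSum k = N) :
    ∃ f : Fin N → ℕ, ∃ hf : IsLevelFunction A.catalanSet n f, hf.toTrapezoid = A := by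
  obtain ⟨f, hfn, hf⟩ := hA.exists_level hN
  have hl : 1 ≤ N + 1 := by omega
  have hentry : ∀ i : Fin n, ∀ j, levelEntry A.catalanSet f i j = A.entry i j := by
    intro i j
    have hrow := A.tailSum_eq_add i j
    by_cases hout : j ∈ Finset.Icc (-(i.val : ℤ)) (((N + 1 : ℕ) : ℤ) + i.val)
    · rw [Finset.mem_Icc] at hout
      push_cast at hout
      by_cases h0 : j ≤ 0
      · rw [levelEntry_left _ f i h0]
        rw [hA.tailSum_eq_zero hN (k := i + 1) i.isLt
          (by rw [Finset.mem_Icc]; push_cast; omega) (Or.inl h0)] at hrow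
        split_ifs with hj
        · rw [← A.tailSum_left hl, ← hj]
          omega
        · rw [hA.tailSum_eq_zero hN (k := i) i.isLt.le
            (by rw [Finset.mem_Icc]; push_cast; omega) (Or.inl h0)] at hrow
          omega
      · by_cases h1 : j ≤ N
        · obtain ⟨c, rfl⟩ := exists_fin_of_mem (by omega) h1
          rw [levelEntry_central, ← hf, ← hf]
          omega
        · rw [levelEntry_right _ f i (by omega)]
          rw [hA.tailSum_eq_zero hN (k := i + 1) i.isLt
            (by rw [Finset.mem_Icc]; push_cast; omega) (Or.inr (by omega))] at hrow
          split_ifs with hj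
          · rw [← A.tailSum_right hl, show (((N + 1 : ℕ) : ℤ) + (i.val : ℤ)) = j by
              push_cast; omega]
            omega
          · rw [hA.tailSum_eq_zero hN (k := i) i.isLt.le
              (by rw [Finset.mem_Icc]; push_cast; omega) (Or.inr (by omega))] at hrow
            omega
    · rw [A.outside i j hout]
      rw [Finset.mem_Icc] at hout
      push_cast at hout
      by_cases h0 : j ≤ 0
      · rw [levelEntry_left _ f i h0, if_neg (by omega)]
      · rw [levelEntry_right _ f i (by omega), if_neg (by omega)]
  -- A partial row sum ending at `x ≤ N` omits the right end cell; its being `0` or `1` is the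
  -- interlacing condition.
  have hprefix : ∀ k < n, ∀ x ≤ N,
      ((negInd A.catalanSet k : ℤ) + (levelCount f k x - levelCount f (k + 1) x) = 0 ∨
        (negInd A.catalanSet k : ℤ) + (levelCount f k x - levelCount f (k + 1) x) = 1) := by
    intro k hk x hx
    have h := A.sum_Icc_mem ⟨k, hk⟩ x
    simp only [← hentry] at h
    rw [sum_levelEntry, if_pos (by omega), if_neg (by omega), Int.toNat_natCast, add_zero] at h
    exact h
  have htotal : ∀ k ≤ n, levelCount f k N + k =
      negCount A.catalanSet k + posCount A.catalanSet k := by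
    intro k hk
    have h1 := A.rangeSum_add hl hk
    have h2 : A.rangeSum k = levelCount f k N := by
      have h3 : ∑ j ∈ Finset.univ.image (fun c : Fin N => (c.val : ℤ) + 1), A.tailSum k j =
          A.rangeSum k := by
        refine Finset.sum_subset (fun j hj => ?_) fun j hj hj' => ?_
        · obtain ⟨c, -, rfl⟩ := Finset.mem_image.mp hj
          rw [Finset.mem_Icc]
          push_cast
          omega
        · refine hA.tailSum_eq_zero hN hk hj ?_
          by_contra hcon
          obtain ⟨c, rfl⟩ := exists_fin_of_mem (N := N) (j := j) (by omega) (by omega)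
          exact hj' (Finset.mem_image_of_mem _ (Finset.mem_univ c))
      rw [← h3, Finset.sum_image fun c _ d _ h => Fin.ext (by simpa using h), levelCount,
        Finset.card_filter]
      push_cast
      refine Finset.sum_congr rfl fun c _ => ?_
      rw [hf]
      simp
    omega
  have hlevel : IsLevelFunction A.catalanSet n f :=
    { pos := fun c => (hfn c).1
      lt := fun c => (hfn c).2
      total := htotal
      upper := fun k hk x hx => by have := hprefix k hk x hx; omega
      lower := fun k hk x hx => by have := hprefix k hk x hx; omega }
  exact ⟨f, hlevel, ASTrapezoid.ext (funext fun i => funext fun j => hentry i j)⟩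

/-- Full trapezoids with the maximal number of central columns correspond to level functions. -/
theorem card_isFull_eq (h0 : 0 ∈ S) (hS : S ⊆ Finset.Icc (-(n : ℤ)) n)
    (hN : ∑ k ∈ Finset.range (n + 1), ((negCount S k : ℤ) + posCount S k - k) = N) :
    Nat.card {A : ASTrapezoid n (N + 1) // A.catalanSet = S ∧ A.IsFull} =
      Nat.card {f : Fin N → ℕ // IsLevelFunction S n f} := by
  symm
  refine Nat.card_congr (Equiv.ofBijective (fun f => ⟨f.2.toTrapezoid,
    f.2.catalanSet_toTrapezoid h0 hS, f.2.isFull_toTrapezoid⟩) ⟨fun f g h => ?_, ?_⟩)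
  · refine Subtype.ext (funext fun c => ?_)
    -- The level of `c` is recovered as the row of the unique `1` in its column.
    have h1 := congrArg (fun A => ASTrapezoid.entry A.1 ⟨f.1 c, f.2.lt c⟩ ((c.val : ℤ) + 1)) h
    change levelEntry S f.1 (f.1 c) _ = levelEntry S g.1 (f.1 c) _ at h1
    rw [levelEntry_central, levelEntry_central, if_pos rfl, if_neg (by omega)] at h1
    split_ifs at h1 <;> omega
  · rintro ⟨A, rfl, hA⟩
    have hN' : ∑ k ∈ Finset.range (n + 1), A.rangeSum k = N := by
      rw [← hN]
      refine Finset.sum_congr rfl fun k hk => ?_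
      have := A.rangeSum_add (by omega) (Nat.lt_succ_iff.mp (Finset.mem_range.mp hk))
      omega
    obtain ⟨f, hf, h⟩ := exists_toTrapezoid_eq hA hN'
    exact ⟨⟨f, hf⟩, Subtype.ext h⟩

end

/-! ### Motzkin paths and centred Catalan sets -/

theorem motzkinSteps_eq (n : ℕ) (S : Finset ℤ) (i : Fin n) :
    motzkinSteps n S i = (negInd S i : ℤ) + posInd S i - 1 := by
  unfold motzkinSteps negInd posInd
  have hne : -((i.val : ℤ) + 1) ≠ (i.val : ℤ) + 1 := by omega
  by_cases h1 : -((i.val : ℤ) + 1) ∈ S <;> by_cases h2 : (i.val : ℤ) + 1 ∈ S <;>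
    simp only [Finset.insert_inter_of_mem, Finset.insert_inter_of_notMem,
      Finset.singleton_inter_of_mem, Finset.singleton_inter_of_notMem, h1, h2, if_true, if_false,
      not_false_eq_true, Finset.card_singleton, Finset.card_empty, insert_empty_eq,
      Finset.card_pair hne] <;> norm_num

namespace MotzkinPath

variable {n : ℕ} (M : MotzkinPath n) {S : Finset ℤ}

theorem height_zero : M.height 0 = 0 := by simp [height]

theorem height_last : M.height n = 0 := by
  have := M.total
  simpa [height] using this

theorem height_nonneg {k : ℕ} (hk : k ≤ n) : 0 ≤ M.height k := M.nonneg k hk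

theorem height_succ (i : Fin n) : M.height (i + 1) = M.height i + M.step i := by
  have : (Finset.univ.filter fun j : Fin n => j.val < i.val + 1) =
      insert i (Finset.univ.filter fun j : Fin n => j.val < i.val) := by
    ext j
    simp only [Finset.mem_filter, Finset.mem_univ, true_and, Finset.mem_insert, Fin.ext_iff]
    omega
  rw [height, this, Finset.sum_insert (by simp), height]
  ring

theorem area_eq_sum : (M.area : ℤ) = ∑ k ∈ Finset.range (n + 1), M.height k := by
  unfold area
  push_cast
  exact Finset.sum_congr rfl fun k hk =>
    Int.toNat_of_nonneg (M.height_nonneg (Nat.lt_succ_iff.mp (Finset.mem_range.mp hk)))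

theorem height_add (hS : motzkinSteps n S = M.step) {k : ℕ} (hk : k ≤ n) :
    M.height k + k = negCount S k + posCount S k := by
  induction k with
  | zero => simp [height_zero, negCount_zero, posCount_zero]
  | succ k ih =>
    have h1 := M.height_succ ⟨k, hk⟩
    have h2 := motzkinSteps_eq n S ⟨k, hk⟩
    rw [hS] at h2
    simp only at h1 h2
    have := ih (by omega)
    rw [negCount_succ, posCount_succ]
    push_cast
    omega

theorem isBalanced (hS : motzkinSteps n S = M.step) (hsub : S ⊆ Finset.Icc (-(n : ℤ)) n) :
    IsBalanced S n := by
  have hneg : ∀ k, n ≤ k → negCount S k = (negElems S).length := fun k hk => by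
    rw [negElems, Finset.length_sort, negCount]
    congr 1
    refine Finset.filter_congr fun x hx => ?_
    have := Finset.mem_Icc.mp (hsub hx)
    omega
  have hpos : ∀ k, n ≤ k → posCount S k = posCount S n := fun k hk => by
    unfold posCount
    congr 1
    refine Finset.filter_congr fun x hx => ?_
    have := Finset.mem_Icc.mp (hsub hx)
    omega
  refine ⟨hneg, fun k hk => ?_, fun k hk => ?_⟩
  · have := M.height_add hS le_rfl
    rw [M.height_last] at this
    rw [hpos k hk, ← hneg n le_rfl]
    omega
  · have := M.height_add hS hk
    have := M.height_nonneg hk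
    omega

theorem card_inter_Icc (h0 : 0 ∈ S) (k : ℕ) :
    (S ∩ Finset.Icc (-(k : ℤ)) k).card = negCount S k + posCount S k + 1 := by
  have : S ∩ Finset.Icc (-(k : ℤ)) k = insert 0 ((S.filter fun x => -(k : ℤ) ≤ x ∧ x < 0) ∪
      S.filter fun x => 0 < x ∧ x ≤ (k : ℤ)) := by
    ext x
    simp only [Finset.mem_inter, Finset.mem_Icc, Finset.mem_insert, Finset.mem_union,
      Finset.mem_filter]
    by_cases hx : x = 0
    · simp [hx, h0]
    · by_cases hxS : x ∈ S
      · simp only [hx, hxS, true_and, false_or]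
        omega
      · simp [hx, hxS]
  rw [this, Finset.card_insert_of_notMem (by simp), Finset.card_union_of_disjoint, negCount,
    posCount]
  rw [Finset.disjoint_left]
  intro x hx hx'
  have := (Finset.mem_filter.mp hx).2
  have := (Finset.mem_filter.mp hx').2
  omega

/-- The Catalan condition is automatic: `S` has `height i + i + 1` elements in `{-i, …, i}`, and
heights are non-negative, the last one being `0`. -/
theorem mem_catalanSetsOver : S ∈ catalanSetsOver M ↔
    0 ∈ S ∧ S ⊆ Finset.Icc (-(n : ℤ)) n ∧ motzkinSteps n S = M.step := by
  simp only [catalanSetsOver, Finset.mem_filter, Finset.mem_powerset]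
  unfold IsCentredCatalan
  constructor
  · rintro ⟨hsub, ⟨-, -, h⟩, hS⟩
    refine ⟨?_, hsub, hS⟩
    have := h 0 (by omega)
    rw [zero_add] at this
    obtain ⟨x, hx⟩ := Finset.card_pos.mp (Nat.lt_of_succ_le this)
    rw [Finset.mem_inter, Finset.mem_Icc] at hx
    push_cast at hx
    rw [show (0 : ℤ) = x by omega]
    exact hx.1
  · rintro ⟨h0, hsub, hS⟩
    refine ⟨hsub, ⟨?_, fun x hx => ?_, fun i hi => ?_⟩, hS⟩
    · have h1 := card_inter_Icc h0 n
      have h2 := M.height_add hS le_rfl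
      rw [Finset.inter_eq_left.mpr hsub] at h1
      rw [M.height_last] at h2
      omega
    · have := Finset.mem_Icc.mp (hsub hx)
      rw [Finset.mem_Icc]
      push_cast
      omega
    · have h1 := card_inter_Icc h0 i
      have h2 := M.height_add hS (Nat.lt_succ_iff.mp hi)
      have h3 := M.height_nonneg (Nat.lt_succ_iff.mp hi)
      omega

theorem catalanSetsOver_nonempty : (catalanSetsOver M).Nonempty := by
  classical
  -- An up step takes both signs, a level step the positive one, a down step neither.
  let S : Finset ℤ := (Finset.Icc (-(n : ℤ)) n).filter fun x =>
    x = 0 ∨ ∃ i : Fin n, (x = (i.val : ℤ) + 1 ∧ 0 ≤ M.step i) ∨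
      (x = -((i.val : ℤ) + 1) ∧ M.step i = 1)
  refine ⟨S, M.mem_catalanSetsOver.mpr ⟨by simp [S], Finset.filter_subset _ _, ?_⟩⟩
  funext i
  have hi := i.isLt
  have h1 : (i.val : ℤ) + 1 ∈ S ↔ 0 ≤ M.step i := by
    simp only [S, Finset.mem_filter, Finset.mem_Icc]
    constructor
    · rintro ⟨-, h | ⟨j, ⟨hj, h⟩ | ⟨hj, h⟩⟩⟩
      · omega
      · rwa [show i = j from Fin.ext (by omega)]
      · omega
    · exact fun h => ⟨by omega, Or.inr ⟨i, Or.inl ⟨rfl, h⟩⟩⟩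
  have h2 : -((i.val : ℤ) + 1) ∈ S ↔ M.step i = 1 := by
    simp only [S, Finset.mem_filter, Finset.mem_Icc]
    constructor
    · rintro ⟨-, h | ⟨j, ⟨hj, h⟩ | ⟨hj, h⟩⟩⟩
      · omega
      · omega
      · rwa [show i = j from Fin.ext (by omega)]
    · exact fun h => ⟨by omega, Or.inr ⟨i, Or.inr ⟨rfl, h⟩⟩⟩
  rw [motzkinSteps_eq]
  simp only [negInd, posInd, h1, h2]
  rcases M.step_mem i with h | h | h <;> simp [h]

theorem card_shapeCells (hS : motzkinSteps n S = M.step) (hsub : S ⊆ Finset.Icc (-(n : ℤ)) n) :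
    (shapeCells S).card = M.area := by
  rw [(M.isBalanced hS hsub).card_shapeCells, area, Finset.sum_range_succ, M.height_last]
  simp only [Int.toNat_zero, add_zero]
  refine Finset.sum_congr rfl fun k hk => ?_
  have := M.height_add hS (Finset.mem_range.mp hk).le
  omega

/-- The number of full trapezoids with `m` central columns whose Motzkin path is `M`. -/
noncomputable def fullWeight (m : ℕ) : ℕ :=
  Nat.card {B : ASTrapezoid n (m + 1) // motzkinSteps n B.catalanSet = M.step ∧ B.IsFull}

theorem motzkinWeight_eq {l : ℕ} (hl : 1 ≤ l) :
    motzkinWeight l M = ∑ m ∈ Finset.range l, (l - 1).choose m * M.fullWeight m :=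
  ASTrapezoid.card_eq_sum_choose n hl fun S => motzkinSteps n S = M.step

theorem fullWeight_eq_zero {m : ℕ} (hm : M.area < m) : M.fullWeight m = 0 := by
  rw [fullWeight, Nat.card_eq_zero]
  left
  refine ⟨fun ⟨B, hB, hfull⟩ => ?_⟩
  have h1 := hfull.le_sum_rangeSum
  have h2 := M.area_eq_sum
  rw [Finset.sum_congr rfl fun k hk => show B.rangeSum k = M.height k by
    have hk := Nat.lt_succ_iff.mp (Finset.mem_range.mp hk)
    have := B.rangeSum_add (by omega) hk
    have := M.height_add hB hk
    omega, ← h2] at h1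
  omega

/-- Split the trapezoids by their centred Catalan set; level functions link each fibre to tableaux.
-/
theorem fullWeight_area : M.fullWeight M.area =
    ∑ S ∈ catalanSetsOver M, numSkewSYT (lambdaDiagram S) (muDiagram S) := by
  have e : {B : ASTrapezoid n (M.area + 1) // motzkinSteps n B.catalanSet = M.step ∧ B.IsFull} ≃
      Σ S : catalanSetsOver M,
        {B : ASTrapezoid n (M.area + 1) // B.catalanSet = S.1 ∧ B.IsFull} :=
    { toFun := fun B => ⟨⟨B.1.catalanSet, M.mem_catalanSetsOver.mpr
        ⟨(B.1.mem_catalanSet (by omega) 0).mpr (Or.inl rfl), B.1.catalanSet_subset (by omega),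
          B.2.1⟩⟩, B.1, rfl, B.2.2⟩
      invFun := fun s => ⟨s.2.1, by
        rw [s.2.2.1]
        exact (M.mem_catalanSetsOver.mp s.1.2).2.2, s.2.2.2⟩
      left_inv := fun B => rfl
      right_inv := by
        rintro ⟨⟨S, hS⟩, B, h, hB⟩
        change B.catalanSet = S at h
        subst h
        rfl }
  rw [fullWeight, Nat.card_congr e, Nat.card_sigma,
    ← Finset.sum_coe_sort (catalanSetsOver M)
      fun S => numSkewSYT (lambdaDiagram S) (muDiagram S)]
  refine Finset.sum_congr rfl fun S _ => ?_
  obtain ⟨h0, hsub, hS⟩ := M.mem_catalanSetsOver.mp S.2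
  rw [numSkewSYT_eq_card (M.isBalanced hS hsub) (M.card_shapeCells hS hsub),
    card_isFull_eq h0 hsub]
  rw [M.area_eq_sum]
  refine Finset.sum_congr rfl fun k hk => ?_
  have := M.height_add hS (Nat.lt_succ_iff.mp (Finset.mem_range.mp hk))
  omega

end MotzkinPath

/-- Every skew shape has a standard filling: number the cells row by row. -/
theorem numSkewSYT_pos (lam mu : YoungDiagram) : 0 < numSkewSYT lam mu := by
  let F : Finset (ℕ ×ₗ ℕ) := (skewCells lam mu).map toLex.toEmbedding
  let e : skewCells lam mu ≃ F := toLex.subtypeEquiv fun a => by simp [F]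
  let o := F.orderIsoOfFin (k := (skewCells lam mu).card) (Finset.card_map _)
  have hlt : ∀ c d : skewCells lam mu, toLex c.val < toLex d.val →
      (e.trans o.symm.toEquiv) c < (e.trans o.symm.toEquiv) d := fun c d h =>
    o.symm.lt_iff_lt.mpr (Subtype.mk_lt_mk.mpr h)
  have : Nonempty {T : skewCells lam mu ≃ Fin (skewCells lam mu).card //
      (∀ c d : skewCells lam mu, c.val.1 = d.val.1 → c.val.2 < d.val.2 → T c < T d) ∧
      (∀ c d : skewCells lam mu, c.val.2 = d.val.2 → c.val.1 < d.val.1 → T c < T d)} :=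
    ⟨e.trans o.symm.toEquiv,
      fun c d h1 h2 => hlt c d (Prod.Lex.toLex_lt_toLex.mpr (Or.inr ⟨h1, h2⟩)),
      fun c d _ h2 => hlt c d (Prod.Lex.toLex_lt_toLex.mpr (Or.inl h2))⟩
  exact Nat.card_pos

/-! ### Polynomials in the binomial basis -/

section

open Polynomial

/-- At `l` this falling factorial equals `m! * (l - 1).choose m`, so its being monic yields the
factor `1 / area!`. -/
theorem monic_descPochhammer_comp (m : ℕ) :
    ((descPochhammer ℚ m).comp (X - C 1)).Monic ∧
      ((descPochhammer ℚ m).comp (X - C 1)).natDegree = m := by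
  refine ⟨(monic_descPochhammer ℚ m).comp (monic_X_sub_C 1) (by rw [natDegree_X_sub_C]; simp), ?_⟩
  rw [natDegree_comp, natDegree_X_sub_C, descPochhammer_natDegree, mul_one]

/-- A combination of the binomial coefficients `(l - 1).choose m`, `m ≤ a`, whose last coefficient
is non-zero, is a polynomial of degree `a` in `l`. -/
theorem exists_polynomial_sum_choose (a : ℕ) (c : ℕ → ℕ) (hc : ∀ m, a < m → c m = 0)
    (ha : c a ≠ 0) :
    ∃ P : ℚ[X], (∀ l : ℕ, 1 ≤ l →
        ((∑ m ∈ Finset.range l, (l - 1).choose m * c m : ℕ) : ℚ) = P.eval (l : ℚ)) ∧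
      P.degree = a ∧ P.leadingCoeff = 1 / (a.factorial : ℚ) * c a := by
  let B : ℕ → ℚ[X] := fun m => (descPochhammer ℚ m).comp (X - C 1)
  let P : ℚ[X] := ∑ m ∈ Finset.range (a + 1), C ((c m : ℚ) / m.factorial) * B m
  have hcoeff : P.coeff a = 1 / (a.factorial : ℚ) * c a := by
    simp only [P, finsetSum_coeff, coeff_C_mul]
    rw [Finset.sum_range_succ, Finset.sum_eq_zero, zero_add]
    · have h := monic_descPochhammer_comp a
      have h1 : (B a).coeff a = 1 := by
        have := h.1.coeff_natDegree
        rwa [h.2] at this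
      rw [h1]
      ring
    · intro m hm
      rw [coeff_eq_zero_of_natDegree_lt, mul_zero]
      rw [(monic_descPochhammer_comp m).2]
      exact Finset.mem_range.mp hm
  have hne : P.coeff a ≠ 0 := by
    rw [hcoeff]
    have : (a.factorial : ℚ) ≠ 0 := by exact_mod_cast a.factorial_ne_zero
    have : (c a : ℚ) ≠ 0 := by exact_mod_cast ha
    positivity
  have hdeg : P.degree = a := by
    refine degree_eq_of_le_of_coeff_ne_zero ?_ hne
    refine natDegree_le_iff_degree_le.mp (natDegree_sum_le_of_forall_le _ _ fun m hm => ?_)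
    refine (natDegree_C_mul_le _ _).trans ?_
    rw [(monic_descPochhammer_comp m).2]
    exact Nat.lt_succ_iff.mp (Finset.mem_range.mp hm)
  refine ⟨P, fun l hl => ?_, hdeg, ?_⟩
  · have h1 : ∑ m ∈ Finset.range l, (l - 1).choose m * c m =
        ∑ m ∈ Finset.range (a + 1), (l - 1).choose m * c m := by
      trans ∑ m ∈ Finset.range (max l (a + 1)), (l - 1).choose m * c m
      · refine Finset.sum_subset (Finset.range_mono (le_max_left _ _)) fun m _ hm => ?_
        rw [Finset.mem_range, not_lt] at hm
        rw [Nat.choose_eq_zero_of_lt (by omega), zero_mul]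
      · refine (Finset.sum_subset (Finset.range_mono (le_max_right _ _)) fun m _ hm => ?_).symm
        rw [Finset.mem_range, not_lt] at hm
        rw [hc m hm, mul_zero]
    rw [h1]
    simp only [P, eval_finsetSum, eval_mul, eval_C, B, eval_comp, eval_sub, eval_X]
    push_cast
    refine Finset.sum_congr rfl fun m _ => ?_
    have h2 : (l : ℚ) - 1 = ((l - 1 : ℕ) : ℚ) := by
      rw [Nat.cast_sub hl, Nat.cast_one]
    have h3 : (m.factorial : ℚ) ≠ 0 := by exact_mod_cast m.factorial_ne_zero
    rw [h2, descPochhammer_eval_eq_descFactorial, Nat.descFactorial_eq_factorial_mul_choose]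
    push_cast
    field_simp
  · rw [leadingCoeff, natDegree_eq_of_degree_eq_some hdeg, hcoeff]

end

theorem mainTheorem4 {n : ℕ} (M : MotzkinPath n) :
    ∃ P : Polynomial ℚ,
      (∀ l : ℕ, 1 ≤ l → (motzkinWeight l M : ℚ) = P.eval (l : ℚ)) ∧
      P.degree = (M.area : WithBot ℕ) ∧
      P.leadingCoeff = 1 / (M.area.factorial : ℚ) *
        ∑ S ∈ catalanSetsOver M, (numSkewSYT (lambdaDiagram S) (muDiagram S) : ℚ) := by
  obtain ⟨P, h1, h2, h3⟩ := exists_polynomial_sum_choose M.area M.fullWeight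
    (fun m hm => M.fullWeight_eq_zero hm) (by
      rw [M.fullWeight_area]
      exact (Finset.sum_pos (fun S _ => numSkewSYT_pos _ _) M.catalanSetsOver_nonempty).ne')
  refine ⟨P, fun l hl => ?_, h2, ?_⟩
  · rw [M.motzkinWeight_eq hl, h1 l hl]
  · rw [h3, M.fullWeight_area]
    push_cast
    rfl
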